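/- For $n\ge 1$ let $\Phi_n(x)=\sum_{k\ge 0}a_n(k)x^k$ be the $n$-th cyclotomic polynomial (with $a_n(k)=0$ for $k>\varphi(n)$), let $A(n)=\max_{k\ge 0}|a_n(k)|$ be its height, and let $A\{n\}=\{a_n(k):k\ge 0\}$ be its set of coefficients. Call $n$ ternary if $n=pqr$ with primes $2<p<q<r$, and call such an $n$ optimal if moreover $A\{n\}$ has exactly $p+1$ elements. Write $\mathbb N=\{1,2,3,\dots\}$ and put $$\mathcal A=\{A(n):n\in\mathbb N\},\qquad \mathcal A_t=\{A(n):n\text{ ternary}\},\qquad \mathcal A_{opt}=\{A(n):n\text{ optimal}\}.$$ Let $p_n$ denote the $n$-th prime ($p_1=2$). If $$p_{n+1}-p_n<\sqrt{p_n}+1\qquad\text{for all } n\ge 31$$ (that is, for all $p_n\ge 127$), then $\mathcal A=\mathbb N$, $\mathcal A_t=\mathbb N$ and $\mathcal A_{opt}=\mathbb N\setminus\{1,5\}$. -/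

import Mathlib

namespace CyclotomicHeights

/-- The set `A{n}` of all coefficients `a_n(k)`, `k ≥ 0`, of the `n`-th cyclotomic polynomial,
where `a_n(k) = 0` for `k` beyond the degree. -/
noncomputable def coeffSet (n : ℕ) : Set ℤ :=
  Set.range fun k : ℕ => (Polynomial.cyclotomic n ℤ).coeff k

/-- The height `A(n)`: the maximum of the absolute values of the coefficients of the `n`-th
cyclotomic polynomial. -/
noncomputable def height (n : ℕ) : ℕ :=
  (Polynomial.cyclotomic n ℤ).support.sup fun k => ((Polynomial.cyclotomic n ℤ).coeff k).natAbs

/-- The height really is the maximum over all `k ≥ 0` of `|a_n(k)|`. -/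
theorem isGreatest_height (n : ℕ) :
    IsGreatest (Set.range fun k : ℕ => ((Polynomial.cyclotomic n ℤ).coeff k).natAbs)
      (height n) := by
  constructor
  · obtain ⟨k, -, hk⟩ := Finset.exists_mem_eq_sup (Polynomial.cyclotomic n ℤ).support
      (Polynomial.support_nonempty.2 (Polynomial.cyclotomic_ne_zero n ℤ))
      (fun k => ((Polynomial.cyclotomic n ℤ).coeff k).natAbs)
    exact ⟨k, hk.symm⟩
  · rintro _ ⟨k, rfl⟩
    by_cases h : k ∈ (Polynomial.cyclotomic n ℤ).support
    · exact Finset.le_sup (f := fun k => ((Polynomial.cyclotomic n ℤ).coeff k).natAbs) h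
    · simp [Polynomial.notMem_support_iff.1 h]

/-- `2 < p < q < r` are primes. -/
def IsTernaryTriple (p q r : ℕ) : Prop :=
  p.Prime ∧ q.Prime ∧ r.Prime ∧ 2 < p ∧ p < q ∧ q < r

/-- `n = pqr` with `2 < p < q < r` primes. -/
def IsTernary (n : ℕ) : Prop :=
  ∃ p q r : ℕ, IsTernaryTriple p q r ∧ n = p * q * r

/-- `n = pqr` is ternary, and its cyclotomic polynomial has exactly `p + 1` distinct
coefficients, `p` being the smallest prime factor. -/
def IsOptimal (n : ℕ) : Prop :=
  ∃ p q r : ℕ, IsTernaryTriple p q r ∧ n = p * q * r ∧ (coeffSet n).ncard = p + 1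

/-- The set of heights of all cyclotomic polynomials. -/
def heights : Set ℕ := {m | ∃ n : ℕ, 1 ≤ n ∧ height n = m}

/-- The set of heights of ternary cyclotomic polynomials. -/
def ternaryHeights : Set ℕ := {m | ∃ n : ℕ, IsTernary n ∧ height n = m}

/-- The set of heights of optimal ternary cyclotomic polynomials. -/
def optimalHeights : Set ℕ := {m | ∃ n : ℕ, IsOptimal n ∧ height n = m}

/-- The set of natural numbers `{1, 2, 3, …}`. -/
def positiveNaturals : Set ℕ := {m | 1 ≤ m}

/-- The `n`-th prime for `n ≥ 1`, so that the first prime is `2`. -/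
noncomputable def nthPrime (n : ℕ) : ℕ := Nat.nth Nat.Prime (n - 1)

end CyclotomicHeights

/-!
Let `p < q < r` be odd primes. Dividing `Φ_{pq}(X ^ r)` by `Φ_{pq}(X)` gives Kaplan's formula: the
coefficient of `Φ_{pqr}` at `k` is a sum of `p` differences of coefficients of `Φ_{pq}`, each
coefficient being replaced by `0` if its exponent exceeds `k / r`. By the Lam–Leung formula
`Φ_{pq}` is explicit in the coordinates `x`, `y` of an exponent `x p + y q` modulo `p q`: its
coefficient is `1` for `x < u`, `y < s`, it is `-1` for `u ≤ x`, `s ≤ y`, and `0` otherwise, where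
`s` and `u` are the inverses of `q` modulo `p` and of `p` modulo `q`. In the sum belonging to `k`,
the coordinates `(x, y)` form an arithmetic progression, `y` running through all residues modulo
`p`, and the summand is the difference of the truncated coefficients at `(x, y)` and `(x, y - t)`,
where `t` is the inverse of `r` modulo `p` (`coeff_eq_sum_sliceDiff`). Everything else is read off
from this formula.

* *Upper bounds.* If `s` is at least as close as `t` to a multiple of `p`, the residue `y`
  determines which sign the summand may have. Hence all coefficients lie in an interval
  with `p + 1` elements, `[t - p, t]` or `[-t, p - t]` (`coeff_mem_Icc_of_sub_s_le`,
  `coeff_mem_Icc_of_s_le`). After exchanging `q` and `r` the hypothesis always holds.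
* *No gaps.* Two neighbouring coefficients differ by an alternating sum over the corners of a
  rectangle in the `(x, y)`-plane, which is at most `1` in absolute value. So the coefficients fill
  an interval (`mem_coeffSet_of_between`), and `pqr` is optimal exactly if both end points of the
  interval above are attained.
* *Attaining the end points.* If `r > p q`, truncation and coordinates can be prescribed
  independently (`exists_coeff_eq`). If `p ≤ 2 t` and `α t ≡ ± 1` modulo `p` for some `α` with
  `2 t - p ≤ α ≤ p - t`, Dirichlet's theorem provides `q` with `s = p - α`, and `r` such
  that the progression of the `x` has a suitable difference and both end points are attained
  (`IsExtremal.coeffSet_eq`, `exists_isExtremal`). This gives an optimal `n` of height `t`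
  (`mem_optimalHeights_of_inverse`). For `t = (p + 1) / 2 + h` such an `α` exists
  if `p ≥ 4 h ^ 2 + 2 h + 3` (`mem_optimalHeights_of_le`).
* *Prime gaps.* For given `m ≥ 64` let `p` be the largest prime below `2 m` and `p'` the next prime.
  Then `m = (p + 1) / 2 + h` with `2 h + 2 ≤ p' - p < √p + 1`, so `p > (2 h + 1) ^ 2` and the
  condition on `p` holds. For `m < 63`, `m ≠ 1, 5`, suitable primes are found by inspection,
  and `m = 63` is obtained from `p = 109`, `α = 45`.
* *The exceptions.* An optimal `n` has a coefficient interval `[-b, p - b]` with `0 < b < p`, which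
  has height at least `2`, and if the height is `5`, then `p = 7` and an end point is `5` or `-5`.
  In that case the summand for every `y` is prescribed, which confines the coordinates `x` to
  intervals; the second differences of a progression modulo `q` being `0` or `± q`, this is
  impossible (`not_sevenDiff_top_five` and its companions). The heights `1` and `5` do belong to
  ternary numbers, namely to `231 = 3 * 7 * 11` and `2717 = 11 * 13 * 19`.
-/

namespace CyclotomicHeights

/-! ### Cyclotomic polynomials of order `p q` -/

open Polynomial in
/-- `Φ_{pq}(X) (1 - X^p) (1 - X^q) = (1 - X) (1 - X^{pq})` for distinct primes `p`, `q`. -/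
theorem cyclotomic_mul_prime_identity {p q : ℕ} (hp : p.Prime) (hq : q.Prime) (hpq : p ≠ q) :
    cyclotomic (p * q) ℤ * ((1 - X ^ p) * (1 - X ^ q)) = (1 - X) * (1 - X ^ (p * q)) := by
  have := Fact.mk hp
  have := Fact.mk hq
  have h1 := cyclotomic_expand_eq_cyclotomic_mul (R := ℤ) hq
    (n := p) (fun h => hpq ((Nat.prime_dvd_prime_iff_eq hq hp).1 h).symm)
  have h2 := cyclotomic_prime_mul_X_sub_one ℤ p
  have h3 := cyclotomic_prime_mul_X_sub_one ℤ q
  have h4 := congrArg (expand ℤ q) h2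
  simp only [map_mul, map_sub, expand_X, map_one, map_pow] at h4
  rw [h1, ← pow_mul, mul_comm q p] at h4
  have h5 : cyclotomic (p * q) ℤ * ((X ^ p - 1) * (X ^ q - 1)) =
      (X - 1) * (X ^ (p * q) - 1) := by
    rw [← h4, ← h2]; ring
  linear_combination h5

open Polynomial in
/-- The Lam–Leung formula: if `u p + s q = p q + 1`, then `Φ_{pq}` is a difference of two
products of geometric sums; the exponents in the second one are those of the form
`p x + q y - p q` with `u ≤ x < q` and `s ≤ y < p`. -/
theorem cyclotomic_mul_prime_eq {p q u s : ℕ} (hp : p.Prime) (hq : q.Prime) (hpq : p ≠ q)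
    (hu : u ≤ q) (hs : s ≤ p) (h : u * p + s * q = p * q + 1) :
    cyclotomic (p * q) ℤ =
      ∑ x ∈ Finset.range u, ∑ y ∈ Finset.range s, (X : ℤ[X]) ^ (p * x + q * y) -
      ∑ x ∈ Finset.range (q - u), ∑ y ∈ Finset.range (p - s),
        (X : ℤ[X]) ^ (1 + p * x + q * y) := by
  have key := cyclotomic_mul_prime_identity hp hq hpq
  have hne : ((1 - X ^ p) * (1 - X ^ q) : ℤ[X]) ≠ 0 := by
    have : ∀ n : ℕ, 0 < n → (1 - X ^ n : ℤ[X]) ≠ 0 := fun n hn h0 =>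
      X_pow_sub_C_ne_zero hn (1 : ℤ) (by rw [← neg_sub, C_1, h0, neg_zero])
    exact mul_ne_zero (this p hp.pos) (this q hq.pos)
  refine mul_right_cancel₀ hne (key.trans ?_)
  have geo : ∀ (a b m n c : ℕ),
      (∑ x ∈ Finset.range m, ∑ y ∈ Finset.range n, (X : ℤ[X]) ^ (c + a * x + b * y)) *
        ((1 - X ^ a) * (1 - X ^ b)) = X ^ c * ((1 - X ^ (a * m)) * (1 - X ^ (b * n))) := by
    intro a b m n c
    have e : (∑ x ∈ Finset.range m, ∑ y ∈ Finset.range n, (X : ℤ[X]) ^ (c + a * x + b * y)) =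
        X ^ c * ((∑ x ∈ Finset.range m, (X ^ a) ^ x) * ∑ y ∈ Finset.range n, (X ^ b) ^ y) := by
      rw [Finset.sum_mul_sum]
      simp only [Finset.mul_sum, pow_add, pow_mul, mul_assoc]
    rw [e, pow_mul, pow_mul, ← mul_neg_geom_sum (X ^ a), ← mul_neg_geom_sum (X ^ b)]
    ring
  have g1 := geo p q u s 0
  have g2 := geo p q (q - u) (p - s) 1
  simp only [zero_add, pow_zero, one_mul] at g1
  rw [sub_mul ((∑ x ∈ Finset.range u, ∑ y ∈ Finset.range s, X ^ (p * x + q * y) : ℤ[X])), g1, g2]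
  obtain ⟨v, rfl⟩ := Nat.exists_eq_add_of_le hu
  obtain ⟨t, rfl⟩ := Nat.exists_eq_add_of_le hs
  simp only [Nat.add_sub_cancel_left]
  have a1 : (X : ℤ[X]) ^ ((s + t) * u) = X * X ^ ((u + v) * t) := by
    rw [← pow_succ']
    congr 1
    linarith
  have a2 : (X : ℤ[X]) ^ ((u + v) * s) = X * X ^ ((s + t) * v) := by
    rw [← pow_succ']
    congr 1
    linarith
  have a3 : (X : ℤ[X]) ^ ((s + t) * u) * X ^ ((u + v) * s) = X * X ^ ((s + t) * (u + v)) := by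
    rw [← pow_add, ← pow_succ']
    congr 1
    linarith
  have a4 : (X : ℤ[X]) * (X ^ ((s + t) * v) * X ^ ((u + v) * t)) = X ^ ((s + t) * (u + v)) := by
    rw [← pow_add, ← pow_succ']
    congr 1
    linarith
  linear_combination a1 + a2 - a3 + a4

/-! ### Coordinates and truncated coefficients of `Φ_{pq}` -/

/-- Three distinct primes `p`, `q`, `r` with `p`, `q` odd, together with the modular inverses
that describe the coefficients of `Φ_{pqr}`: `s` and `t` are the inverses of `q` and `r` modulo
`p`, `u` is the inverse of `p` modulo `q`, and `w` is an inverse of `pr` modulo `q`. -/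
structure TernaryDatum where
  (p q r : ℕ)
  (s t u w : ℤ)
  prime_p : p.Prime
  prime_q : q.Prime
  prime_r : r.Prime
  two_lt_p : 2 < p
  two_lt_q : 2 < q
  p_ne_q : p ≠ q
  p_ne_r : p ≠ r
  q_ne_r : q ≠ r
  s_pos : 0 < s
  s_lt : s < p
  u_pos : 0 < u
  u_lt : u < q
  bezout : u * p + s * q = p * q + 1
  t_pos : 0 < t
  t_lt : t < p
  t_inv : (p : ℤ) ∣ r * t - 1
  w_inv : (q : ℤ) ∣ r * p * w - 1

/-- For `0 ≤ x < q` and `0 ≤ y < p` this is the coefficient of `Φ_{pq}` at the exponent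
`j ≡ x p + y q` modulo `p q`, `0 ≤ j < p q`, replaced by `0` if `j > z`. -/
def truncCoeff (p q s u z x y : ℤ) : ℤ :=
  if x < u ∧ y < s ∧ x * p + y * q ≤ z then 1
  else if u ≤ x ∧ s ≤ y ∧ x * p + y * q - p * q ≤ z then -1
  else 0

namespace TernaryDatum

variable (D : TernaryDatum)

/-- The truncated coefficient of `Φ_{pq}` belonging to the residue class of `n / r` modulo
`p q`, the truncation being at the real number `n / r`. -/
def slice (n : ℤ) : ℤ :=
  truncCoeff D.p D.q D.s D.u (n / D.r) (n * D.w % D.q) (n * (D.s * D.t) % D.p)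

theorem p_pos : (0 : ℤ) < D.p := by exact_mod_cast D.prime_p.pos
theorem q_pos : (0 : ℤ) < D.q := by exact_mod_cast D.prime_q.pos
theorem r_pos : (0 : ℤ) < D.r := by exact_mod_cast D.prime_r.pos

theorem isCoprime_p_q : IsCoprime (D.p : ℤ) D.q :=
  Nat.isCoprime_iff_coprime.2 ((Nat.coprime_primes D.prime_p D.prime_q).2 D.p_ne_q)

theorem isCoprime_p_r : IsCoprime (D.p : ℤ) D.r :=
  Nat.isCoprime_iff_coprime.2 ((Nat.coprime_primes D.prime_p D.prime_r).2 D.p_ne_r)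

theorem isCoprime_q_r : IsCoprime (D.q : ℤ) D.r :=
  Nat.isCoprime_iff_coprime.2 ((Nat.coprime_primes D.prime_q D.prime_r).2 D.q_ne_r)

theorem s_inv : (D.p : ℤ) ∣ D.q * D.s - 1 :=
  ⟨D.q - D.u, by linear_combination D.bezout⟩

/-- The coordinates of `n` solve `r (x p + y q) ≡ n` modulo `p q`. -/
theorem dvd_coord (n : ℤ) : (D.p * D.q : ℤ) ∣
    n - D.r * (n * D.w % D.q * D.p + n * (D.s * D.t) % D.p * D.q) := by
  refine D.isCoprime_p_q.mul_dvd ?_ ?_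
  · obtain ⟨a, ha⟩ := D.t_inv
    obtain ⟨b, hb⟩ := D.s_inv
    have h := Int.emod_add_mul_ediv (n * (D.s * D.t)) D.p
    generalize n * (D.s * D.t) % D.p = y at *
    generalize n * (D.s * D.t) / D.p = d at *
    refine ⟨-n * a * D.q * D.s - n * b - D.r * (n * D.w % D.q) + D.r * D.q * d, ?_⟩
    linear_combination (-n * D.q * D.s) * ha - n * hb - D.r * D.q * h
  · obtain ⟨a, ha⟩ := D.w_inv
    have h := Int.emod_add_mul_ediv (n * D.w) D.q
    generalize n * D.w % D.q = x at *
    generalize n * D.w / D.q = d at *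
    refine ⟨-n * a - D.r * (n * (D.s * D.t) % D.p) + D.r * D.p * d, ?_⟩
    linear_combination (-n) * ha - D.r * D.p * h

/-- The coordinates of `n` are the only solution of `r (x p + y q) ≡ n` modulo `p q` in the
rectangle `0 ≤ x < q`, `0 ≤ y < p`. -/
theorem coord_unique {n x y : ℤ} (hx0 : 0 ≤ x) (hxq : x < D.q) (hy0 : 0 ≤ y) (hyp : y < D.p)
    (h : (D.p * D.q : ℤ) ∣ n - D.r * (x * D.p + y * D.q)) :
    x = n * D.w % D.q ∧ y = n * (D.s * D.t) % D.p := by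
  have h2 := dvd_sub (D.dvd_coord n) h
  have hx1 := Int.emod_nonneg (n * D.w) D.q_pos.ne'
  have hx2 := Int.emod_lt_of_pos (n * D.w) D.q_pos
  have hy1 := Int.emod_nonneg (n * (D.s * D.t)) D.p_pos.ne'
  have hy2 := Int.emod_lt_of_pos (n * (D.s * D.t)) D.p_pos
  generalize n * D.w % D.q = x' at *
  generalize n * (D.s * D.t) % D.p = y' at *
  have e : n - D.r * (x' * D.p + y' * D.q) - (n - D.r * (x * D.p + y * D.q)) =
    D.r * ((x - x') * D.p + (y - y') * D.q) := by ring
  rw [e] at h2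
  constructor
  · have h3 := (D.isCoprime_q_r.dvd_of_dvd_mul_left ((Dvd.intro_left _ rfl).trans h2))
    have h4 := (D.isCoprime_p_q.symm.dvd_of_dvd_mul_right
      ((Int.dvd_add_left (Dvd.intro_left _ rfl)).1 h3))
    have h5 := Int.eq_zero_of_abs_lt_dvd h4 (by rw [abs_lt]; constructor <;> linarith)
    linarith
  · have h3 := (D.isCoprime_p_r.dvd_of_dvd_mul_left ((Dvd.intro _ rfl).trans h2))
    have h4 := (D.isCoprime_p_q.dvd_of_dvd_mul_right
      ((Int.dvd_add_right (Dvd.intro_left _ rfl)).1 h3))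
    have h5 := Int.eq_zero_of_abs_lt_dvd h4 (by rw [abs_lt]; constructor <;> linarith)
    linarith

theorem pq_add_one_le {x y : ℤ} (hx : D.u ≤ x) (hy : D.s ≤ y) :
    1 ≤ x * D.p + y * D.q - D.p * D.q := by
  nlinarith [D.bezout, mul_le_mul_of_nonneg_right hx D.p_pos.le,
    mul_le_mul_of_nonneg_right hy D.q_pos.le]

/-- The two truncations of the slice at `n` agree: the one at `n / r` and the one at `k / r`,
if `n ≤ k < n + p q`. -/
theorem slice_eq_truncCoeff {n k : ℤ} (h1 : n ≤ k) (h2 : k < n + D.p * D.q) :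
    D.slice n = truncCoeff D.p D.q D.s D.u (k / D.r) (n * D.w % D.q)
      (n * (D.s * D.t) % D.p) := by
  have key : ∀ j m : ℤ, n - D.r * j = D.p * D.q * m → (j ≤ n / D.r ↔ j ≤ k / D.r) := by
    intro j m hm
    rw [Int.le_ediv_iff_mul_le D.r_pos, Int.le_ediv_iff_mul_le D.r_pos]
    constructor
    · intro h; linarith
    · intro h
      have : 0 ≤ m := by
        by_contra hneg
        have : (D.p * D.q : ℤ) * m ≤ D.p * D.q * (-1) :=
          mul_le_mul_of_nonneg_left (by omega) (mul_pos D.p_pos D.q_pos).le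
        linarith
      have := mul_nonneg (mul_pos D.p_pos D.q_pos).le this
      linarith
  obtain ⟨m, hm⟩ := D.dvd_coord n
  have k1 := key _ m hm
  have k2 := key (n * D.w % D.q * D.p + n * (D.s * D.t) % D.p * D.q - D.p * D.q)
    (m + D.r) (by linear_combination hm)
  simp only [slice, truncCoeff, k1, k2]

theorem slice_of_neg {n : ℤ} (h : n < 0) : D.slice n = 0 := by
  have hz : n / D.r < 0 := Int.ediv_neg_of_neg_of_pos h D.r_pos
  have hx := Int.emod_nonneg (n * D.w) D.q_pos.ne'
  have hy := Int.emod_nonneg (n * (D.s * D.t)) D.p_pos.ne'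
  have hJ := mul_nonneg hx D.p_pos.le
  have hJ' := mul_nonneg hy D.q_pos.le
  rw [slice, truncCoeff, if_neg, if_neg]
  · rintro ⟨h1, h2, h3⟩
    linarith [D.pq_add_one_le h1 h2]
  · rintro ⟨h1, h2, h3⟩
    linarith

/-- Passing from `n - p q` to `n`, the slice changes exactly when `n` is `r` times the exponent
belonging to the coordinates of `n`. -/
theorem slice_sub_slice (n : ℤ) : D.slice n - D.slice (n - D.p * D.q) =
    (if n * D.w % D.q < D.u ∧ n * (D.s * D.t) % D.p < D.s ∧
      n = D.r * (n * D.w % D.q * D.p + n * (D.s * D.t) % D.p * D.q) then 1 else 0) -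
    (if D.u ≤ n * D.w % D.q ∧ D.s ≤ n * (D.s * D.t) % D.p ∧
      n = D.r * (n * D.w % D.q * D.p + n * (D.s * D.t) % D.p * D.q - D.p * D.q)
      then 1 else 0) := by
  have e1 : (n - D.p * D.q) * D.w % D.q = n * D.w % D.q := by
    rw [show (n - D.p * D.q) * D.w = n * D.w + D.q * (-D.p * D.w) by ring,
      Int.add_mul_emod_self_left]
  have e2 : (n - D.p * D.q) * (D.s * D.t) % D.p = n * (D.s * D.t) % D.p := by
    rw [show (n - D.p * D.q) * (D.s * D.t) = n * (D.s * D.t) + D.p * (-D.q * (D.s * D.t)) by ring,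
      Int.add_mul_emod_self_left]
  have key : ∀ j m : ℤ, n - D.r * j = D.p * D.q * m →
      (n = D.r * j ↔ j ≤ n / D.r ∧ ¬ j ≤ (n - D.p * D.q) / D.r) ∧
      (j ≤ (n - D.p * D.q) / D.r → j ≤ n / D.r) := by
    intro j m hm
    have hpq := mul_pos D.p_pos D.q_pos
    rw [Int.le_ediv_iff_mul_le D.r_pos, Int.le_ediv_iff_mul_le D.r_pos]
    refine ⟨⟨fun h => ⟨by linarith, by linarith⟩, fun ⟨h1, h2⟩ => ?_⟩, fun h => by linarith⟩
    have m0 : 0 ≤ m := by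
      by_contra hneg
      nlinarith [show m ≤ -1 by omega]
    have m1 : m < 1 := by
      by_contra hneg
      nlinarith [show 1 ≤ m by omega]
    have : m = 0 := by omega
    subst this
    linarith
  obtain ⟨m, hm⟩ := D.dvd_coord n
  obtain ⟨k1, k1'⟩ := key _ m hm
  obtain ⟨k2, k2'⟩ := key (n * D.w % D.q * D.p + n * (D.s * D.t) % D.p * D.q - D.p * D.q)
    (m + D.r) (by linear_combination hm)
  simp only [slice, truncCoeff, e1, e2, k1, k2]
  generalize n * D.w % D.q = x at *
  generalize n * (D.s * D.t) % D.p = y at *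
  split_ifs <;> grind

end TernaryDatum

/-! ### Kaplan's formula -/

namespace TernaryDatum

variable (D : TernaryDatum)

theorem sum_sum_ite_eq_and (m n a b : ℕ) (C : Prop) [Decidable C] :
    (∑ x ∈ Finset.range m, ∑ y ∈ Finset.range n, if x = a ∧ y = b ∧ C then (1 : ℤ) else 0) =
      if a < m ∧ b < n ∧ C then 1 else 0 := by
  by_cases hC : C <;> simp [ite_and, hC]

open Polynomial in
/-- In terms of power series: `Φ_{pq}(X ^ r)` is `1 - X ^ (p q)` times the generating series of
the slices. -/
theorem coeff_expand_cyclotomic (n : ℕ) :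
    (expand ℤ D.r (cyclotomic (D.p * D.q) ℤ)).coeff n =
      D.slice n - D.slice ((n : ℤ) - D.p * D.q) := by
  have hs0 := D.s_pos
  have hs1 := D.s_lt
  have hu0 := D.u_pos
  have hu1 := D.u_lt
  have hb := D.bezout
  rw [slice_sub_slice]
  have cu := @coord_unique D n
  have hx1 := Int.emod_nonneg (n * D.w) D.q_pos.ne'
  have hx2 := Int.emod_lt_of_pos (n * D.w) D.q_pos
  have hy1 := Int.emod_nonneg (n * (D.s * D.t)) D.p_pos.ne'
  have hy2 := Int.emod_lt_of_pos (n * (D.s * D.t)) D.p_pos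
  generalize (n : ℤ) * D.w % D.q = a at *
  generalize (n : ℤ) * (D.s * D.t) % D.p = b at *
  generalize D.s = s at *
  generalize D.u = u at *
  lift a to ℕ using hx1
  lift b to ℕ using hy1
  lift s to ℕ using hs0.le
  lift u to ℕ using hu0.le
  rw [cyclotomic_mul_prime_eq D.prime_p D.prime_q D.p_ne_q (u := u) (s := s) (by omega)
    (by omega) (by exact_mod_cast hb)]
  simp only [map_sub, map_sum, map_pow, expand_X, ← pow_mul, coeff_sub, finsetSum_coeff,
    coeff_X_pow]
  congr 1
  · have : ∀ x ∈ Finset.range u, ∀ y ∈ Finset.range s,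
        (n = D.r * (D.p * x + D.q * y) ↔ x = a ∧ y = b ∧
          (n : ℤ) = D.r * ((a : ℤ) * D.p + (b : ℤ) * D.q)) := by
      intro x hx y hy
      rw [Finset.mem_range] at hx hy
      constructor
      · intro h
        have h' : (n : ℤ) = D.r * ((x : ℤ) * D.p + (y : ℤ) * D.q) := by rw [h]; push_cast; ring
        obtain ⟨h1, h2⟩ := cu (x := x) (y := y) (by omega) (by omega) (by omega) (by omega)
          ⟨0, by linarith⟩
        rw [h1, h2] at h'
        exact ⟨by exact_mod_cast h1, by exact_mod_cast h2, h'⟩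
      · rintro ⟨rfl, rfl, h⟩
        have : (n : ℤ) = (D.r * (D.p * x + D.q * y) : ℕ) := by push_cast; linarith
        exact_mod_cast this
    rw [Finset.sum_congr rfl fun x hx => Finset.sum_congr rfl fun y hy =>
      if_congr (this x hx y hy) rfl rfl, sum_sum_ite_eq_and]
    simp only [Nat.cast_lt]
  · have : ∀ x ∈ Finset.range (D.q - u), ∀ y ∈ Finset.range (D.p - s),
        (n = D.r * (1 + D.p * x + D.q * y) ↔ x = a - u ∧ y = b - s ∧
          ((u : ℤ) ≤ a ∧ (s : ℤ) ≤ b ∧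
          (n : ℤ) = D.r * ((a : ℤ) * D.p + (b : ℤ) * D.q - D.p * D.q))) := by
      intro x hx y hy
      rw [Finset.mem_range] at hx hy
      constructor
      · intro h
        have h' : (n : ℤ) = D.r * (((u + x : ℕ) : ℤ) * D.p + ((s + y : ℕ) : ℤ) * D.q
            - D.p * D.q) := by
          rw [h]; push_cast; linear_combination (-D.r : ℤ) * hb
        obtain ⟨h1, h2⟩ := cu (x := (u + x : ℕ)) (y := (s + y : ℕ)) (by omega) (by omega)
          (by omega) (by omega) ⟨-D.r, by linear_combination h'⟩
        rw [h1, h2] at h'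
        exact ⟨by omega, by omega, by omega, by omega, h'⟩
      · rintro ⟨h1, h2, h3, h4, h⟩
        have e1 : (a : ℤ) = u + x := by omega
        have e2 : (b : ℤ) = s + y := by omega
        rw [e1, e2] at h
        have : (n : ℤ) = (D.r * (1 + D.p * x + D.q * y) : ℕ) := by
          push_cast; linear_combination h + D.r * hb
        exact_mod_cast this
    rw [Finset.sum_congr rfl fun x hx => Finset.sum_congr rfl fun y hy =>
      if_congr (this x hx y hy) rfl rfl, sum_sum_ite_eq_and]
    refine if_congr ⟨fun h => h.2.2, fun h => ⟨by omega, by omega, h⟩⟩ rfl rfl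

/-- The generating series of the slices. -/
noncomputable def sliceSeries : PowerSeries ℤ := PowerSeries.mk fun n => D.slice n

theorem coeff_X_pow_mul_sliceSeries (d n : ℕ) :
    PowerSeries.coeff n (PowerSeries.X ^ d * D.sliceSeries) = D.slice ((n : ℤ) - d) := by
  rw [PowerSeries.coeff_X_pow_mul']
  split_ifs with h
  · rw [sliceSeries, PowerSeries.coeff_mk, Nat.cast_sub h]
  · rw [D.slice_of_neg (by omega)]

open Polynomial in
/-- Kaplan's formula for generating series. It combines `Φ_{pqr}(X) Φ_{pq}(X) = Φ_{pq}(X ^ r)` with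
`Φ_{pq}(X) (1 - X ^ p) (1 - X ^ q) = (1 - X) (1 - X ^ (p q))`. -/
theorem coe_cyclotomic_eq :
    ((cyclotomic (D.p * D.q * D.r) ℤ : ℤ[X]) : PowerSeries ℤ) =
      (∑ i ∈ Finset.range D.p, PowerSeries.X ^ i) * (1 - PowerSeries.X ^ D.q) *
        D.sliceSeries := by
  have h1 := cyclotomic_expand_eq_cyclotomic_mul (R := ℤ) D.prime_r (n := D.p * D.q)
    (by
      rw [D.prime_r.dvd_mul, Nat.prime_dvd_prime_iff_eq D.prime_r D.prime_p,
        Nat.prime_dvd_prime_iff_eq D.prime_r D.prime_q]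
      rintro (h | h)
      · exact D.p_ne_r h.symm
      · exact D.q_ne_r h.symm)
  have h2 := cyclotomic_mul_prime_identity D.prime_p D.prime_q D.p_ne_q
  have h3 : ((expand ℤ D.r (cyclotomic (D.p * D.q) ℤ) : ℤ[X]) : PowerSeries ℤ) =
      (1 - PowerSeries.X ^ (D.p * D.q)) * D.sliceSeries := by
    ext n
    rw [Polynomial.coeff_coe, coeff_expand_cyclotomic, sub_mul, one_mul, map_sub,
      coeff_X_pow_mul_sliceSeries, sliceSeries, PowerSeries.coeff_mk]
    push_cast
    rfl
  have h4 := congrArg (fun f : ℤ[X] => (f : PowerSeries ℤ)) h1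
  have h5 := congrArg (fun f : ℤ[X] => (f : PowerSeries ℤ)) h2
  simp only [Polynomial.coe_mul, Polynomial.coe_sub, Polynomial.coe_one, Polynomial.coe_pow,
    Polynomial.coe_X] at h4 h5
  rw [h3] at h4
  have ne : ∀ n : ℕ, 0 < n → (1 - PowerSeries.X ^ n : PowerSeries ℤ) ≠ 0 := by
    intro n hn h0
    have := congrArg (PowerSeries.coeff 0) h0
    simp [hn.ne'] at this
  have n1 := ne 1 one_pos
  have n2 := ne _ (Nat.mul_pos D.prime_p.pos D.prime_q.pos)
  rw [pow_one] at n1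
  refine mul_right_cancel₀ n1 (mul_right_cancel₀ n2 ?_)
  have g := mul_neg_geom_sum (PowerSeries.X : PowerSeries ℤ) D.p
  calc _ = ((cyclotomic (D.p * D.q * D.r) ℤ : ℤ[X]) : PowerSeries ℤ) *
        ((1 - PowerSeries.X) * (1 - PowerSeries.X ^ (D.p * D.q))) := by ring
    _ = (1 - PowerSeries.X ^ (D.p * D.q)) * D.sliceSeries *
        ((1 - PowerSeries.X ^ D.p) * (1 - PowerSeries.X ^ D.q)) := by rw [← h5, h4]; ring
    _ = _ := by rw [← g]; ring

open Polynomial in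
/-- Kaplan's formula: every coefficient of `Φ_{pqr}` is a sum of `p` differences of slices. -/
theorem coeff_cyclotomic_eq_sum_slice (k : ℕ) :
    (cyclotomic (D.p * D.q * D.r) ℤ).coeff k =
      ∑ i ∈ Finset.range D.p, (D.slice ((k : ℤ) - i) - D.slice ((k : ℤ) - i - D.q)) := by
  rw [← Polynomial.coeff_coe, coe_cyclotomic_eq, mul_assoc, Finset.sum_mul, map_sum]
  refine Finset.sum_congr rfl fun i _ => ?_
  rw [sub_mul, one_mul, mul_sub, map_sub, ← mul_assoc, ← pow_add, coeff_X_pow_mul_sliceSeries,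
    coeff_X_pow_mul_sliceSeries]
  push_cast
  rw [sub_sub (k : ℤ) i]

open Polynomial in
theorem coeff_cyclotomic_succ_sub (k : ℕ) :
    (cyclotomic (D.p * D.q * D.r) ℤ).coeff (k + 1) -
      (cyclotomic (D.p * D.q * D.r) ℤ).coeff k =
      D.slice ((k + 1 : ℤ)) - D.slice ((k + 1 : ℤ) - D.p) - D.slice ((k + 1 : ℤ) - D.q)
        + D.slice ((k + 1 : ℤ) - D.p - D.q) := by
  rw [coeff_cyclotomic_eq_sum_slice, coeff_cyclotomic_eq_sum_slice]
  have := Finset.sum_range_sub' (fun i : ℕ => D.slice ((k + 1 : ℤ) - i)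
    - D.slice ((k + 1 : ℤ) - i - D.q)) D.p
  rw [← Finset.sum_sub_distrib]
  simp only [Nat.cast_zero, sub_zero] at this
  rw [show D.slice ((k + 1 : ℤ)) - D.slice ((k + 1 : ℤ) - D.p) - D.slice ((k + 1 : ℤ) - D.q)
        + D.slice ((k + 1 : ℤ) - D.p - D.q) = D.slice ((k + 1 : ℤ)) - D.slice ((k + 1 : ℤ) - D.q)
        - (D.slice ((k + 1 : ℤ) - D.p) - D.slice ((k + 1 : ℤ) - D.p - D.q)) by ring, ← this]
  refine Finset.sum_congr rfl fun i _ => ?_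
  push_cast
  rw [show (k + 1 : ℤ) - (i + 1) = k - i by ring]

end TernaryDatum

/-! ### Neighbouring coefficients, and bounds for all coefficients -/

/-- On the corners of a rectangle, the alternating sum of truncated coefficients of `Φ_{pq}` is
at most `1` in absolute value: the exponents at opposite corners have equal sums, so if two
opposite corners survive the truncation, so does a third one. -/
theorem truncCoeff_rectangle (p q s u z x y x' y' : ℤ) :
    -1 ≤ truncCoeff p q s u z x y - truncCoeff p q s u z x' y - truncCoeff p q s u z x y'
      + truncCoeff p q s u z x' y' ∧
    truncCoeff p q s u z x y - truncCoeff p q s u z x' y - truncCoeff p q s u z x y'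
      + truncCoeff p q s u z x' y' ≤ 1 := by
  simp only [truncCoeff]
  generalize x * p = a
  generalize x' * p = a'
  generalize y * q = b
  generalize y' * q = b'
  generalize p * q = c
  split_ifs <;> omega

/-- An affine map with invertible slope permutes the residues modulo `p`, so `m` of the first
`p` values lie in an interval of `m` residues. -/
theorem sum_ite_affine_mod {p : ℕ} (hp : 0 < p) {c : ℤ} (hc : IsCoprime c p) (d a b : ℤ)
    (ha : 0 ≤ a) (hab : a ≤ b) (hb : b ≤ p) :
    (∑ i ∈ Finset.range p, if a ≤ (d - i * c) % p ∧ (d - i * c) % p < b then (1 : ℤ) else 0)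
      = b - a := by
  have hp' : (0 : ℤ) < p := by exact_mod_cast hp
  lift a to ℕ using ha
  lift b to ℕ using by omega
  have hinj : Set.InjOn (fun i : ℕ => ((d - i * c) % p).toNat) (Finset.range p) := by
    intro i hi j hj h
    simp only [Finset.coe_range, Set.mem_Iio] at hi hj
    have h1 := Int.emod_nonneg (d - i * c) hp'.ne'
    have h2 := Int.emod_nonneg (d - j * c) hp'.ne'
    have h3 : (d - i * c) % p = (d - j * c) % p := by
      simp only at h
      omega
    have h5 : (p : ℤ) ∣ (d - i * c) - (d - j * c) := Int.ModEq.dvd h3.symm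
    rw [show (d - i * c) - (d - j * c) = c * (j - i) by ring] at h5
    have h6 := Int.eq_zero_of_abs_lt_dvd (hc.symm.dvd_of_dvd_mul_left h5)
      (by rw [abs_lt]; constructor <;> omega)
    omega
  have himg : (Finset.range p).image (fun i : ℕ => ((d - i * c) % p).toNat) = Finset.range p := by
    refine Finset.eq_of_subset_of_card_le (fun y hy => ?_) ?_
    · obtain ⟨i, -, rfl⟩ := Finset.mem_image.1 hy
      have h1 := Int.emod_nonneg (d - i * c) hp'.ne'
      have h2 := Int.emod_lt_of_pos (d - i * c) hp'
      rw [Finset.mem_range]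
      omega
    · rw [Finset.card_image_of_injOn hinj]
  have e : (∑ i ∈ Finset.range p, if a ≤ (d - i * c) % p ∧ (d - i * c) % p < b
      then (1 : ℤ) else 0) = ∑ y ∈ Finset.range p, if a ≤ y ∧ y < b then (1 : ℤ) else 0 := by
    conv_rhs => rw [← himg]
    rw [Finset.sum_image hinj]
    refine Finset.sum_congr rfl fun i _ => ?_
    have h1 := Int.emod_nonneg (d - i * c) hp'.ne'
    exact if_congr (by omega) rfl rfl
  rw [e, ← Finset.sum_filter, Finset.sum_const, nsmul_eq_mul, mul_one]
  have : (Finset.range p).filter (fun y => a ≤ y ∧ y < b) = Finset.Ico a b := by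
    ext y
    simp only [Finset.mem_filter, Finset.mem_range, Finset.mem_Ico]
    omega
  rw [this, Nat.card_Ico]
  omega

namespace TernaryDatum

variable (D : TernaryDatum)

/-- The summand of Kaplan's formula at the coordinates `x`, `y`. -/
def sliceDiff (z x y : ℤ) : ℤ :=
  truncCoeff D.p D.q D.s D.u z x y - truncCoeff D.p D.q D.s D.u z x ((y - D.t) % D.p)

theorem p_add_q_lt : (D.p + D.q : ℤ) < D.p * D.q := by
  have h1 : (3 : ℤ) ≤ D.p := by exact_mod_cast D.two_lt_p
  have h2 : (3 : ℤ) ≤ D.q := by exact_mod_cast D.two_lt_q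
  nlinarith

theorem x_coord_sub_q (n : ℤ) : (n - D.q) * D.w % D.q = n * D.w % D.q := by
  rw [show (n - D.q) * D.w = n * D.w + D.q * (-D.w) by ring, Int.add_mul_emod_self_left]

theorem y_coord_sub_q (n : ℤ) :
    (n - D.q) * (D.s * D.t) % D.p = (n * (D.s * D.t) - D.t) % D.p := by
  obtain ⟨a, ha⟩ := D.s_inv
  rw [show (n - D.q) * (D.s * D.t) = n * (D.s * D.t) - D.t + D.p * (-a * D.t) by
    linear_combination (-D.t) * ha, Int.add_mul_emod_self_left]

theorem y_coord_sub_p (n : ℤ) : (n - D.p) * (D.s * D.t) % D.p = n * (D.s * D.t) % D.p := by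
  rw [show (n - D.p) * (D.s * D.t) = n * (D.s * D.t) + D.p * (-(D.s * D.t)) by ring,
    Int.add_mul_emod_self_left]

/-- Kaplan's formula in coordinates. The slices at `k - i` and `k - i - q` may both be truncated
at `k / r`, and subtracting `q` moves only the second coordinate, by `t`. -/
theorem coeff_eq_sum_sliceDiff (k : ℕ) :
    (Polynomial.cyclotomic (D.p * D.q * D.r) ℤ).coeff k =
      ∑ i ∈ Finset.range D.p, D.sliceDiff (k / D.r) (((k : ℤ) - i) * D.w % D.q)
        (((k : ℤ) - i) * (D.s * D.t) % D.p) := by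
  rw [coeff_cyclotomic_eq_sum_slice]
  refine Finset.sum_congr rfl fun i hi => ?_
  rw [Finset.mem_range] at hi
  have h := D.p_add_q_lt
  rw [D.slice_eq_truncCoeff (n := (k : ℤ) - i) (k := k) (by omega) (by omega),
    D.slice_eq_truncCoeff (n := (k : ℤ) - i - D.q) (k := k) (by omega) (by omega),
    x_coord_sub_q, y_coord_sub_q, sliceDiff, Int.emod_sub_emod]

/-- Neighbouring coefficients of `Φ_{pqr}` differ by at most one. -/
theorem abs_coeff_succ_sub_le (k : ℕ) :
    |(Polynomial.cyclotomic (D.p * D.q * D.r) ℤ).coeff (k + 1) -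
      (Polynomial.cyclotomic (D.p * D.q * D.r) ℤ).coeff k| ≤ 1 := by
  rw [coeff_cyclotomic_succ_sub]
  have h := D.p_add_q_lt
  have hp := D.p_pos
  have hq := D.q_pos
  rw [D.slice_eq_truncCoeff (n := k + 1) (k := k + 1) (by omega) (by omega),
    D.slice_eq_truncCoeff (n := (k + 1 : ℤ) - D.p) (k := k + 1) (by omega) (by omega),
    D.slice_eq_truncCoeff (n := (k + 1 : ℤ) - D.q) (k := k + 1) (by omega) (by omega),
    D.slice_eq_truncCoeff (n := (k + 1 : ℤ) - D.p - D.q) (k := k + 1) (by omega) (by omega),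
    x_coord_sub_q, x_coord_sub_q, sub_right_comm (k + 1 : ℤ), y_coord_sub_p, y_coord_sub_p]
  exact abs_le.2 (truncCoeff_rectangle ..)

/-- Any integer between two coefficients of `Φ_{pqr}` is a coefficient. -/
theorem mem_coeffSet_of_between {a b m : ℤ} (ha : a ∈ coeffSet (D.p * D.q * D.r))
    (hb : b ∈ coeffSet (D.p * D.q * D.r)) (h1 : a ≤ m) (h2 : m ≤ b) :
    m ∈ coeffSet (D.p * D.q * D.r) := by
  obtain ⟨i, hi⟩ := ha
  obtain ⟨j, hj⟩ := hb
  set f := fun k : ℕ => (Polynomial.cyclotomic (D.p * D.q * D.r) ℤ).coeff k with hf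
  have step : ∀ k, |f (k + 1) - f k| ≤ 1 := D.abs_coeff_succ_sub_le
  have up : ∀ d k, f k ≤ m → m ≤ f (k + d) → ∃ l, f l = m := by
    intro d
    induction d with
    | zero => exact fun k h h' => ⟨k, le_antisymm h h'⟩
    | succ d ih =>
      intro k h h'
      by_cases hk : f (k + 1) ≤ m
      · exact ih (k + 1) hk (by rwa [Nat.add_right_comm] )
      · have := abs_le.1 (step k)
        exact ⟨k, by omega⟩
  have down : ∀ d k, m ≤ f k → f (k + d) ≤ m → ∃ l, f l = m := by
    intro d
    induction d with
    | zero => exact fun k h h' => ⟨k, le_antisymm h' h⟩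
    | succ d ih =>
      intro k h h'
      by_cases hk : m ≤ f (k + 1)
      · exact ih (k + 1) hk (by rwa [Nat.add_right_comm] )
      · have := abs_le.1 (step k)
        exact ⟨k, by omega⟩
  change f i = a at hi
  change f j = b at hj
  rcases le_total i j with h | h
  · obtain ⟨d, rfl⟩ := Nat.exists_eq_add_of_le h
    exact up d i (by omega) (by omega)
  · obtain ⟨d, rfl⟩ := Nat.exists_eq_add_of_le h
    exact down d j (by omega) (by omega)

theorem emod_sub_t {y : ℤ} (h0 : 0 ≤ y) (hp : y < D.p) :
    (D.t ≤ y ∧ (y - D.t) % D.p = y - D.t) ∨ (y < D.t ∧ (y - D.t) % D.p = y - D.t + D.p) := by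
  have := D.t_pos
  have := D.t_lt
  rcases le_or_gt D.t y with h | h
  · exact Or.inl ⟨h, Int.emod_eq_of_lt (by omega) (by omega)⟩
  · refine Or.inr ⟨h, ?_⟩
    rw [← Int.add_emod_right]
    exact Int.emod_eq_of_lt (by omega) (by omega)

theorem isCoprime_s_mul_t : IsCoprime (D.s * D.t) (D.p : ℤ) := by
  obtain ⟨a, ha⟩ := D.s_inv
  obtain ⟨b, hb⟩ := D.t_inv
  exact IsCoprime.mul_left ⟨D.q, -a, by linear_combination ha⟩ ⟨D.r, -b, by linear_combination hb⟩

/-- If `p - s` is at most `t` and `p - t`, the summands equal to `1` have `y < t`, and the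
summands equal to `-1` have `t ≤ y`. -/
theorem sliceDiff_of_sub_s_le (h1 : D.p - D.s ≤ D.t) (h2 : D.p - D.s ≤ D.p - D.t) {z x y : ℤ}
    (hy0 : 0 ≤ y) (hyp : y < D.p) :
    D.sliceDiff z x y ≤ (if 0 ≤ y ∧ y < D.t then 1 else 0) ∧
      -(if D.t ≤ y ∧ y < D.p then 1 else 0) ≤ D.sliceDiff z x y := by
  have hs := D.s_lt
  have hs' := D.s_pos
  have ht := mul_pos D.t_pos D.q_pos
  have ht' := mul_pos (sub_pos.2 D.t_lt) D.q_pos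
  simp only [sliceDiff, truncCoeff]
  rcases D.emod_sub_t hy0 hyp with ⟨h, e⟩ | ⟨h, e⟩
  · rw [e, sub_mul]
    split_ifs <;> constructor <;> omega
  · rw [e, add_mul, sub_mul]
    rw [sub_mul] at ht'
    split_ifs <;> constructor <;> omega

/-- If `s` is at most `t` and `p - t`, the summands equal to `-1` have `s ≤ y < s + t`, and the
summands equal to `1` do not. -/
theorem sliceDiff_of_s_le (h1 : D.s ≤ D.t) (h2 : D.s ≤ D.p - D.t) {z x y : ℤ}
    (hy0 : 0 ≤ y) (hyp : y < D.p) :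
    D.sliceDiff z x y ≤ 1 - (if D.s ≤ y ∧ y < D.s + D.t then 1 else 0) ∧
      -(if D.s ≤ y ∧ y < D.s + D.t then 1 else 0) ≤ D.sliceDiff z x y := by
  have hs := D.s_lt
  have hs' := D.s_pos
  have ht := mul_pos D.t_pos D.q_pos
  have ht' := mul_pos (sub_pos.2 D.t_lt) D.q_pos
  simp only [sliceDiff, truncCoeff]
  rcases D.emod_sub_t hy0 hyp with ⟨h, e⟩ | ⟨h, e⟩
  · rw [e, sub_mul]
    split_ifs <;> constructor <;> omega
  · rw [e, add_mul, sub_mul]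
    rw [sub_mul] at ht'
    split_ifs <;> constructor <;> omega

theorem coeff_mem_Icc_of_sub_s_le (h1 : D.p - D.s ≤ D.t) (h2 : D.p - D.s ≤ D.p - D.t) (k : ℕ) :
    (Polynomial.cyclotomic (D.p * D.q * D.r) ℤ).coeff k ∈ Set.Icc (D.t - D.p) D.t := by
  have key := fun i : ℕ => D.sliceDiff_of_sub_s_le h1 h2 (z := k / D.r)
    (x := ((k : ℤ) - i) * D.w % D.q) (y := ((k : ℤ) - i) * (D.s * D.t) % D.p)
    (Int.emod_nonneg _ D.p_pos.ne') (Int.emod_lt_of_pos _ D.p_pos)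
  have c1 := sum_ite_affine_mod D.prime_p.pos D.isCoprime_s_mul_t (k * (D.s * D.t)) 0 D.t
    le_rfl D.t_pos.le D.t_lt.le
  have c2 := sum_ite_affine_mod D.prime_p.pos D.isCoprime_s_mul_t (k * (D.s * D.t)) D.t D.p
    D.t_pos.le D.t_lt.le le_rfl
  simp only [← sub_mul] at c1 c2
  rw [coeff_eq_sum_sliceDiff]
  have l1 := Finset.sum_le_sum fun i (_ : i ∈ Finset.range D.p) => (key i).1
  have l2 := Finset.sum_le_sum fun i (_ : i ∈ Finset.range D.p) => (key i).2
  rw [c1] at l1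
  rw [Finset.sum_neg_distrib, c2] at l2
  exact ⟨by linarith, by linarith⟩

theorem coeff_mem_Icc_of_s_le (h1 : D.s ≤ D.t) (h2 : D.s ≤ D.p - D.t) (k : ℕ) :
    (Polynomial.cyclotomic (D.p * D.q * D.r) ℤ).coeff k ∈ Set.Icc (-D.t) (D.p - D.t) := by
  have key := fun i : ℕ => D.sliceDiff_of_s_le h1 h2 (z := k / D.r)
    (x := ((k : ℤ) - i) * D.w % D.q) (y := ((k : ℤ) - i) * (D.s * D.t) % D.p)
    (Int.emod_nonneg _ D.p_pos.ne') (Int.emod_lt_of_pos _ D.p_pos)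
  have c := sum_ite_affine_mod D.prime_p.pos D.isCoprime_s_mul_t (k * (D.s * D.t)) D.s
    (D.s + D.t) D.s_pos.le (by linarith [D.t_pos]) (by linarith)
  simp only [← sub_mul, add_sub_cancel_left] at c
  rw [coeff_eq_sum_sliceDiff]
  have l1 := Finset.sum_le_sum fun i (_ : i ∈ Finset.range D.p) => (key i).1
  have l2 := Finset.sum_le_sum fun i (_ : i ∈ Finset.range D.p) => (key i).2
  rw [Finset.sum_sub_distrib, c, Finset.sum_const, Finset.card_range, nsmul_eq_mul, mul_one] at l1
  rw [Finset.sum_neg_distrib, c] at l2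
  exact ⟨by linarith, by linarith⟩

end TernaryDatum

/-! ### A criterion for the largest possible coefficient set -/

theorem truncCoeff_eq_one {p q s u z x y : ℤ} (hx : x < u) (hy : y < s)
    (h : x * p + y * q ≤ z) : truncCoeff p q s u z x y = 1 :=
  if_pos ⟨hx, hy, h⟩

theorem truncCoeff_eq_neg_one {p q s u z x y : ℤ} (hx : u ≤ x) (hy : s ≤ y)
    (h : x * p + y * q - p * q ≤ z) : truncCoeff p q s u z x y = -1 := by
  rw [truncCoeff, if_neg (by omega), if_pos ⟨hx, hy, h⟩]

theorem truncCoeff_of_lt_of_le {p q s u z x y : ℤ} (hx : x < u) (hy : s ≤ y) :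
    truncCoeff p q s u z x y = 0 := by
  rw [truncCoeff, if_neg (by omega), if_neg (by omega)]

theorem truncCoeff_of_lt_of_cut {p q s u z x y : ℤ} (hx : x < u) (h : z < x * p + y * q) :
    truncCoeff p q s u z x y = 0 := by
  rw [truncCoeff, if_neg (by omega), if_neg (by omega)]

theorem truncCoeff_of_le_of_lt {p q s u z x y : ℤ} (hx : u ≤ x) (hy : y < s) :
    truncCoeff p q s u z x y = 0 := by
  rw [truncCoeff, if_neg (by omega), if_neg (by omega)]

theorem truncCoeff_nonneg_of_lt {p q s u z x y : ℤ} (hx : x < u) :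
    0 ≤ truncCoeff p q s u z x y := by
  rw [truncCoeff]
  split_ifs <;> omega

namespace TernaryDatum

variable (D : TernaryDatum)

/-- If `r ≥ p q`, the truncation and the residue class modulo `p q` can be prescribed
independently: every arithmetic progression of coordinates with differences `-ε w` and `1`
(where `s t ≡ -ε` modulo `p` and `ε = ±1`) belongs to a coefficient of `Φ_{pqr}`. -/
theorem exists_coeff_eq (hr : D.p * D.q ≤ D.r) {ε : ℤ} (hε : ε = 1 ∨ ε = -1)
    (hst : (D.p : ℤ) ∣ D.s * D.t + ε) {z : ℤ} (hz : 0 ≤ z) (x y : ℤ) :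
    (∑ j ∈ Finset.range D.p, D.sliceDiff z ((x - j * (ε * D.w)) % D.q) ((y + j) % D.p)) ∈
      coeffSet (D.p * D.q * D.r) := by
  have hr' : (D.p * D.q : ℤ) ≤ D.r := by exact_mod_cast hr
  have hpq := mul_pos D.p_pos D.q_pos
  -- The progression starts at `m`, and ends there if `ε = -1`, when it is traversed backwards.
  -- The index `k` is the number with `k ≡ k₀` modulo `p q` that lies in `[r z, r z + p q)`.
  set m : ℤ := D.r * (x * D.p + y * D.q) with hm
  set k₀ : ℤ := if ε = 1 then m else m + (D.p - 1) with hk₀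
  obtain ⟨a, ha⟩ := D.t_inv
  obtain ⟨b, hb⟩ := D.s_inv
  obtain ⟨c, hc⟩ := D.w_inv
  obtain ⟨d, hd⟩ := hst
  have hk1 := Int.emod_nonneg (k₀ - D.r * z) hpq.ne'
  have hk2 := Int.emod_lt_of_pos (k₀ - D.r * z) hpq
  have hk3 := Int.emod_add_mul_ediv (k₀ - D.r * z) (D.p * D.q)
  set e := (k₀ - D.r * z) / (D.p * D.q) with he
  set k : ℤ := D.r * z + (k₀ - D.r * z) % (D.p * D.q) with hk
  have hkz : k / D.r = z := by
    rw [hk, Int.mul_add_ediv_left _ _ D.r_pos.ne', Int.ediv_eq_zero_of_lt hk1 (by omega), add_zero]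
  have hk0 : 0 ≤ k := by have := mul_nonneg D.r_pos.le hz; omega
  refine ⟨k.toNat, ?_⟩
  simp only
  rw [coeff_eq_sum_sliceDiff, Int.toNat_of_nonneg hk0, hkz]
  have xmod : ∀ A B C : ℤ, A = B + D.q * C → A % D.q = B % D.q := by
    rintro A B C rfl
    exact Int.add_mul_emod_self_left ..
  have ymod : ∀ A B C : ℤ, A = B + D.p * C → A % D.p = B % D.p := by
    rintro A B C rfl
    exact Int.add_mul_emod_self_left ..
  have hke : k = k₀ - D.p * D.q * e := by linarith
  rcases hε with rfl | rfl
  · rw [if_pos rfl] at hk₀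
    refine Finset.sum_congr rfl fun i _ => ?_
    congr 1
    · refine xmod _ _ (x * c + D.r * y * D.w - D.p * e * D.w) ?_
      rw [hke, hk₀, hm]
      linear_combination x * hc
    · refine ymod _ _ (D.r * x * (D.s * D.t) + y * (a * D.q * D.s + b)
        - D.q * e * (D.s * D.t) - i * d) ?_
      rw [hke, hk₀, hm]
      linear_combination y * D.q * D.s * ha + y * hb - i * hd
  · rw [if_neg (by norm_num)] at hk₀
    rw [← Finset.sum_range_reflect]
    refine Finset.sum_congr rfl fun i hi => ?_
    rw [Finset.mem_range] at hi
    have hcast : ((D.p - 1 - i : ℕ) : ℤ) = D.p - 1 - i := by omega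
    rw [hcast]
    congr 1
    · refine xmod _ _ (x * c + D.r * y * D.w - D.p * e * D.w) ?_
      rw [hke, hk₀, hm]
      linear_combination x * hc
    · refine ymod _ _ (D.r * x * (D.s * D.t) + y * (a * D.q * D.s + b)
        - D.q * e * (D.s * D.t) + i * d) ?_
      rw [hke, hk₀, hm]
      linear_combination y * D.q * D.s * ha + y * hb + i * hd

/-- Arithmetic conditions under which `Φ_{pqr}` has the largest possible set of coefficients.
Here `α = p - s`, `B = p - t`, and `W = ε w` is the difference of the progressions of first
coordinates; the bounds on `W` say that `W p / q` lies between `(α - 1) / (B + α - 1)` and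
`α / (B + α - 1)`, up to rounding, and that the progressions do not leave `[0, q)`. -/
structure IsExtremal (ε α B W : ℤ) : Prop where
  sign : ε = 1 ∨ ε = -1
  dvd : (D.p : ℤ) ∣ D.s * D.t + ε
  w_eq : ε * D.w = W
  s_add : D.s + α = D.p
  t_add : D.t + B = D.p
  α_pos : 0 < α
  α_le : α ≤ B
  B_le : B ≤ D.t
  t_le : D.t ≤ B + α
  lower : (α - 1) * D.q + 1 ≤ (B + α - 1) * (W * D.p)
  upper : (B + α - 1) * (W * D.p) ≤ α * D.q - D.p + 1
  range : D.u - 1 + D.t * W < D.q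
  r_ge : D.p * D.q ≤ D.r

namespace IsExtremal

variable {D} {ε α B W : ℤ}

theorem W_pos (h : D.IsExtremal ε α B W) : 0 < W := by
  have h1 := h.lower
  have h2 := h.α_pos
  have h3 := h.α_le
  by_contra hW
  have h4 : W * D.p ≤ 0 := mul_nonpos_of_nonpos_of_nonneg (by omega) D.p_pos.le
  have h5 := mul_nonneg (show 0 ≤ α - 1 by omega) D.q_pos.le
  have h6 := mul_nonneg (show 0 ≤ B + α - 1 by omega) (neg_nonneg.2 h4)
  linarith

theorem W_mul_p_lt (h : D.IsExtremal ε α B W) : W * D.p < D.q := by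
  have h1 := h.upper
  have h2 := h.α_pos
  have h3 := h.α_le
  have hp : (2 : ℤ) < D.p := by exact_mod_cast D.two_lt_p
  by_contra hW
  have h4 := mul_le_mul_of_nonneg_left (not_lt.1 hW) (show 0 ≤ B + α - 1 by omega)
  have h5 := mul_nonneg (show 0 ≤ B - 1 by omega) D.q_pos.le
  linarith

theorem u_sub_one_mul (h : D.IsExtremal ε α B W) : (D.u - 1) * D.p = α * D.q - D.p + 1 := by
  linear_combination D.bezout - D.q * h.s_add

theorem le_u (h : D.IsExtremal ε α B W) : (B + α - 1) * W ≤ D.u - 1 := by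
  have h1 := h.upper
  rw [← h.u_sub_one_mul, ← mul_assoc] at h1
  exact le_of_mul_le_mul_right h1 D.p_pos

/-- The progression of coordinates that produces the coefficient `t`. Its second coordinate starts
at `y = B`, and its first coordinate decreases by `W`, passing below `u` at step `t - α`. With the
given truncation, all summands with `y < t` are `1` and none is negative. -/
theorem ite_le_sliceDiff (h : D.IsExtremal ε α B W) {j y : ℤ} (hy0 : 0 ≤ y) (hyp : y < D.p)
    (hj : j = if B ≤ y then y - B else y + D.t) :
    (if 0 ≤ y ∧ y < D.t then 1 else 0) ≤
      D.sliceDiff ((D.u - 1) * D.p + (B - α) * D.q - 1) (D.u - 1 + (D.t - α - j) * W) y := by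
  have hW := h.W_pos
  have hV := h.W_mul_p_lt
  have hV0 := mul_pos hW D.p_pos
  obtain ⟨-, -, -, hs, ht, hα, hαB, hBt, htα, lower, -, -, -⟩ := h
  have hq := D.q_pos
  have hxp : ∀ c : ℤ, (D.u - 1 + c * W) * D.p = (D.u - 1) * D.p + c * (W * D.p) := by
    intro c; ring
  have hpq : (D.p * D.q : ℤ) = D.s * D.q + α * D.q := by rw [← hs]; ring
  have kind₁ : ∀ c : ℤ, c ≤ 0 → D.u - 1 + c * W < D.u := by
    intro c hc; nlinarith
  have kind₂ : ∀ c : ℤ, 0 < c → D.u ≤ D.u - 1 + c * W := by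
    intro c hc; nlinarith
  rw [sliceDiff]
  generalize hVV : W * D.p = V at *
  rcases D.emod_sub_t hy0 hyp with ⟨hty, e⟩ | ⟨hty, e⟩
  · rw [e, if_neg (by omega)]
    rw [if_pos (by omega)] at hj
    subst hj
    rcases lt_or_ge y D.s with hys | hys
    · rw [truncCoeff_of_le_of_lt (kind₂ _ (by omega)) hys,
        truncCoeff_of_le_of_lt (kind₂ _ (by omega)) (by omega), sub_zero]
    · have hx := kind₁ (D.t - α - (y - B)) (by omega)
      rw [truncCoeff_of_lt_of_le hx hys, truncCoeff_of_lt_of_cut hx, sub_zero]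
      rw [hxp]
      nlinarith [mul_nonneg (show 0 ≤ y - D.s by omega) (show 0 ≤ (D.q : ℤ) - V by omega)]
  · rw [e, if_pos ⟨hy0, hty⟩]
    rcases le_or_gt B y with hBy | hBy
    · rw [if_pos hBy] at hj
      subst hj
      have hx := kind₂ (D.t - α - (y - B)) (by omega)
      rw [truncCoeff_of_le_of_lt hx (by omega), truncCoeff_eq_neg_one hx (by omega)]
      · norm_num
      · rw [hxp]
        nlinarith [mul_nonneg (show 0 ≤ D.t - α - (y - B) - 1 by omega)
          (show 0 ≤ (D.q : ℤ) - V by omega)]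
    · rw [if_neg (by omega)] at hj
      subst hj
      have hx := kind₁ (D.t - α - (y + D.t)) (by omega)
      rw [truncCoeff_eq_one hx (by omega), truncCoeff_of_lt_of_cut hx, sub_zero]
      · rw [hxp]
        nlinarith [mul_nonneg (show 0 ≤ α + y by omega) (show 0 ≤ (D.q : ℤ) - V by omega)]
      · rw [hxp]
        nlinarith [mul_nonneg (show 0 ≤ B - 1 - y by omega) (show 0 ≤ (D.q : ℤ) - V by omega)]

/-- The progression of coordinates that produces the coefficient `t - p`. Its second coordinate
starts at `y = s`, and its first coordinate decreases by `W`, passing below `u` at step `t`. With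
the given truncation, all summands with `t ≤ y` are `-1` and none is positive. -/
theorem sliceDiff_le_ite (h : D.IsExtremal ε α B W) {j y : ℤ} (hy0 : 0 ≤ y) (hyp : y < D.p)
    (hj : j = if D.s ≤ y then y - D.s else y + α) :
    D.sliceDiff ((D.u - 1) * D.p + (D.t - α) * D.q - 1) (D.u - 1 + (D.t - j) * W) y ≤
      -(if D.t ≤ y ∧ y < D.p then 1 else 0) := by
  have hW := h.W_pos
  have hV := h.W_mul_p_lt
  have hV0 := mul_pos hW D.p_pos
  obtain ⟨-, -, -, hs, ht, hα, hαB, hBt, htα, lower, -, -, -⟩ := h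
  have hq := D.q_pos
  have hxp : ∀ c : ℤ, (D.u - 1 + c * W) * D.p = (D.u - 1) * D.p + c * (W * D.p) := by
    intro c; ring
  have hpq : (D.p * D.q : ℤ) = D.s * D.q + α * D.q := by rw [← hs]; ring
  have kind₁ : ∀ c : ℤ, c ≤ 0 → D.u - 1 + c * W < D.u := by
    intro c hc; nlinarith
  have kind₂ : ∀ c : ℤ, 0 < c → D.u ≤ D.u - 1 + c * W := by
    intro c hc; nlinarith
  rw [sliceDiff]
  generalize hVV : W * D.p = V at *
  rcases le_or_gt D.s y with hsy | hsy
  · rw [if_pos hsy] at hj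
    subst hj
    have hx := kind₂ (D.t - (y - D.s)) (by omega)
    rw [if_pos (by omega)]
    rcases D.emod_sub_t hy0 hyp with ⟨hty, e⟩ | ⟨hty, e⟩
    · rw [e, truncCoeff_of_le_of_lt (y := y - D.t) hx (by omega), truncCoeff_eq_neg_one hx hsy]
      · norm_num
      · rw [hxp]
        nlinarith [mul_nonneg (show 0 ≤ D.t - (y - D.s) - 1 by omega)
          (show 0 ≤ (D.q : ℤ) - V by omega)]
    · omega
  · rw [if_neg (by omega)] at hj
    subst hj
    rcases D.emod_sub_t hy0 hyp with ⟨hty, e⟩ | ⟨hty, e⟩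
    · rw [e, if_pos (by omega)]
      have hx := kind₁ (D.t - (y + α)) (by omega)
      rw [truncCoeff_of_lt_of_cut hx, truncCoeff_eq_one hx (by omega)]
      · norm_num
      · rw [hxp]
        nlinarith [mul_nonneg (show 0 ≤ y + α - D.t by omega) hV0.le,
          mul_nonneg (show 0 ≤ B - 1 - (y + α - D.t) by omega) hq.le,
          mul_nonneg (show 0 ≤ D.t - B by omega) hq.le]
      · rw [hxp]
        nlinarith [mul_nonneg (show 0 ≤ y + α - D.t by omega) (show 0 ≤ (D.q : ℤ) - V by omega)]
    · rw [e, if_neg (by omega), neg_zero, sub_nonpos]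
      rcases lt_or_ge y (D.t - α) with h1 | h1
      · rw [truncCoeff_of_le_of_lt (kind₂ _ (by omega)) hsy,
          truncCoeff_of_le_of_lt (kind₂ _ (by omega)) (by omega)]
      · have hx := kind₁ (D.t - (y + α)) (by omega)
        rw [truncCoeff_of_lt_of_cut hx]
        · exact truncCoeff_nonneg_of_lt hx
        · rw [hxp]
          nlinarith [mul_nonneg (show 0 ≤ y + α - D.t by omega)
            (show 0 ≤ (D.q : ℤ) - V by omega)]

/-- The two progressions attain the end points of the interval of
`coeff_mem_Icc_of_sub_s_le`, and neighbouring coefficients fill the rest. -/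
theorem coeffSet_eq (h : D.IsExtremal ε α B W) :
    coeffSet (D.p * D.q * D.r) = Set.Icc (D.t - D.p) D.t := by
  have hs := h.s_add
  have ht := h.t_add
  have hα := h.α_pos
  have hαB := h.α_le
  have hBt := h.B_le
  have htα := h.t_le
  have hu := h.le_u
  have hrange := h.range
  have hW := h.W_pos
  have bound := D.coeff_mem_Icc_of_sub_s_le (by omega) (by omega)
  have hup : 1 ≤ (D.u - 1) * D.p := by
    have := mul_pos (show 0 < B + α - 1 by omega) hW
    nlinarith [D.p_pos]
  have cop : IsCoprime (-1 : ℤ) D.p := isCoprime_one_left.neg_left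
  have affine : ∀ (y : ℤ) (j : ℕ), (y - j * (-1)) % (D.p : ℤ) = (y + j) % D.p := by
    intro y j; congr 1; ring
  have reduce : ∀ c : ℤ, -(B + α - 1) ≤ c → c ≤ D.t →
      (D.u - 1 + c * W) % D.q = D.u - 1 + c * W := by
    intro c h1 h2
    refine Int.emod_eq_of_lt ?_ ?_ <;> nlinarith
  -- The progression of second coordinates starts at `B`.
  have top : D.t ∈ coeffSet (D.p * D.q * D.r) := by
    have hmem := D.exists_coeff_eq h.r_ge h.sign h.dvd
      (z := (D.u - 1) * D.p + (B - α) * D.q - 1)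
      (by have := mul_nonneg (sub_nonneg.2 hαB) D.q_pos.le; omega) (D.u - 1 + (D.t - α) * W) B
    rw [h.w_eq] at hmem
    have hc := sum_ite_affine_mod D.prime_p.pos cop B 0 D.t le_rfl D.t_pos.le D.t_lt.le
    simp only [affine, sub_zero] at hc
    have hle := Finset.sum_le_sum fun (j : ℕ) (hj : j ∈ Finset.range D.p) =>
      h.ite_le_sliceDiff (j := j) (y := (B + j) % D.p) (Int.emod_nonneg _ D.p_pos.ne')
        (Int.emod_lt_of_pos _ D.p_pos) (by
          rw [Finset.mem_range] at hj
          rcases lt_or_ge (B + j) (D.p : ℤ) with h1 | h1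
          · rw [Int.emod_eq_of_lt (by omega) h1, if_pos (by omega)]; ring
          · rw [← Int.sub_emod_right, Int.emod_eq_of_lt (by omega) (by omega), if_neg (by omega)]
            omega)
    rw [hc] at hle
    rw [Finset.sum_congr rfl (g := fun j : ℕ => D.sliceDiff
      ((D.u - 1) * D.p + (B - α) * D.q - 1) (D.u - 1 + (D.t - α - j) * W) ((B + j) % D.p))
      (fun j hj => by
        rw [Finset.mem_range] at hj
        rw [show D.u - 1 + (D.t - α) * W - j * W = D.u - 1 + (D.t - α - j) * W by ring,
          reduce _ (by omega) (by omega)])] at hmem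
    obtain ⟨k, hk⟩ := hmem
    have := (bound k).2
    simp only at hk
    rw [hk] at this
    exact ⟨k, hk.trans (le_antisymm this hle)⟩
  -- The progression of second coordinates starts at `s`.
  have bot : D.t - D.p ∈ coeffSet (D.p * D.q * D.r) := by
    have hmem := D.exists_coeff_eq h.r_ge h.sign h.dvd
      (z := (D.u - 1) * D.p + (D.t - α) * D.q - 1)
      (by have := mul_nonneg (show 0 ≤ D.t - α by omega) D.q_pos.le; omega)
      (D.u - 1 + D.t * W) D.s
    rw [h.w_eq] at hmem
    have hc := sum_ite_affine_mod D.prime_p.pos cop D.s D.t D.p D.t_pos.le D.t_lt.le le_rfl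
    simp only [affine] at hc
    have hle := Finset.sum_le_sum fun (j : ℕ) (hj : j ∈ Finset.range D.p) =>
      h.sliceDiff_le_ite (j := j) (y := (D.s + j) % D.p) (Int.emod_nonneg _ D.p_pos.ne')
        (Int.emod_lt_of_pos _ D.p_pos) (by
          rw [Finset.mem_range] at hj
          rcases lt_or_ge (D.s + j) (D.p : ℤ) with h1 | h1
          · rw [Int.emod_eq_of_lt (by omega) h1, if_pos (by omega)]; ring
          · rw [← Int.sub_emod_right, Int.emod_eq_of_lt (by omega) (by omega), if_neg (by omega)]
            omega)
    rw [Finset.sum_neg_distrib, hc] at hle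
    rw [Finset.sum_congr rfl (g := fun j : ℕ => D.sliceDiff
      ((D.u - 1) * D.p + (D.t - α) * D.q - 1) (D.u - 1 + (D.t - j) * W) ((D.s + j) % D.p))
      (fun j hj => by
        rw [Finset.mem_range] at hj
        rw [show D.u - 1 + D.t * W - j * W = D.u - 1 + (D.t - j) * W by ring,
          reduce _ (by omega) (by omega)])] at hmem
    obtain ⟨k, hk⟩ := hmem
    have := (bound k).1
    simp only at hk
    rw [hk] at this
    exact ⟨k, hk.trans (le_antisymm (by linarith) this)⟩
  refine Set.Subset.antisymm ?_ fun m hm => D.mem_coeffSet_of_between bot top hm.1 hm.2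
  rintro _ ⟨k, rfl⟩
  exact bound k

end IsExtremal
end TernaryDatum

/-! ### Existence of optimal numbers of given height -/

namespace TernaryDatum

/-- For a given odd prime `p` and given residues `t` and `s = p - α`, Dirichlet's theorem
provides primes `q` and `r` for which `Φ_{pqr}` is extremal. -/
theorem exists_isExtremal {p : ℕ} (hp : p.Prime) (hp2 : 2 < p) {t B α ε : ℤ}
    (hε : ε = 1 ∨ ε = -1) (htB : t + B = p) (hα : 0 < α) (hαB : α ≤ B) (hBt : B ≤ t)
    (htα : t ≤ B + α) (hdvd : (p : ℤ) ∣ α * t - ε) :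
    ∃ (D : TernaryDatum) (W : ℤ), D.p = p ∧ D.t = t ∧ D.p < D.q ∧ D.q < D.r ∧
      D.IsExtremal ε α B W := by
  have hp0 : (0 : ℤ) < p := by exact_mod_cast hp.pos
  have hεε : ε * ε = 1 := by rcases hε with rfl | rfl <;> norm_num
  obtain ⟨d, hd⟩ := hdvd
  set N := B + α - 1 with hN
  have hN1 : 1 ≤ N := by omega
  have hαN : α ≤ N := by omega
  have cop_t : IsCoprime (-ε * t) (p : ℤ) :=
    ⟨-α, -d * ε, by linear_combination ε * hd + hεε⟩
  obtain ⟨q, hqgt, hq, hqmod⟩ := Nat.forall_exists_prime_gt_and_zmodEq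
    (p + (t * N * p + N * p).toNat) hp.ne_zero cop_t
  have hq0 : (0 : ℤ) < q := by exact_mod_cast hq.pos
  have hqbig : p + (t * N * p + N * p) < (q : ℤ) := by omega
  have hpq : p < q := by omega
  have htNp : 0 ≤ t * N * p := mul_nonneg (mul_nonneg (by omega) (by omega)) hp0.le
  have hNp : 0 < N * p := mul_pos (by omega) hp0
  obtain ⟨e, he⟩ := hqmod.dvd
  -- `s = p - α` is inverse to `q` modulo `p`.
  obtain ⟨c, hc⟩ : (p : ℤ) ∣ (p - α) * q - 1 :=
    ⟨q + ε * d + α * e, by linear_combination ε * hd + hεε + α * he⟩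
  have hcpos : 0 < c := by
    have h1 : (q : ℤ) ≤ (p - α) * q := by nlinarith [show 1 ≤ p - α by omega]
    have h2 : 1 < (q : ℤ) := by exact_mod_cast hq.one_lt
    exact pos_of_mul_pos_right (by linarith : 0 < (p : ℤ) * c) hp0.le
  have hcq : c < q := by
    have h1 : 0 < α * q := mul_pos hα hq0
    exact lt_of_mul_lt_mul_left (by linarith : (p : ℤ) * c < p * q) hp0.le
  -- The least admissible difference of the first coordinates.
  set W := (α - 1) * q / (N * p) + 1 with hW
  have hW1 := Int.emod_add_mul_ediv ((α - 1) * q) (N * p)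
  have hW2 := Int.emod_nonneg ((α - 1) * q) hNp.ne'
  have hW3 := Int.emod_lt_of_pos ((α - 1) * q) hNp
  have hW4 : N * p * W = (α - 1) * q - (α - 1) * q % (N * p) + N * p := by
    rw [hW]; linarith
  have lower : (α - 1) * q + 1 ≤ N * (W * p) := by linarith
  have upper' : N * (W * p) ≤ (α - 1) * q + N * p := by linarith
  have upper : N * (W * p) ≤ α * q - p + 1 := by linarith
  have hWpos : 0 < W := by
    have h0 := mul_nonneg (show 0 ≤ α - 1 by omega) hq0.le
    have := Int.ediv_nonneg h0 hNp.le
    omega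
  have hWp : W * p < q := by
    by_contra hneg
    have h4 := mul_le_mul_of_nonneg_left (not_lt.1 hneg) (show 0 ≤ N by omega)
    have h5 := mul_nonneg (show 0 ≤ N - α by omega) hq0.le
    linarith [show (2 : ℤ) < p by exact_mod_cast hp2]
  have hWq : W < q := by nlinarith
  have range : q - c - 1 + t * W < q := by
    have h1 : (p : ℤ) * (q - c - 1) = α * q - p + 1 := by linear_combination hc
    have h2 : N * (p * (q - c - 1 + t * W)) ≤
        N * (α * q - p + 1) + t * ((α - 1) * q + N * p) := by
      have := mul_le_mul_of_nonneg_left upper' (show 0 ≤ t by omega)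
      rw [mul_add, h1]
      linarith
    have h3 : N * (α * q - p + 1) + t * ((α - 1) * q + N * p) < N * (p * q) := by
      have e1 : 1 ≤ N * (p - α) - t * (α - 1) := by
        nlinarith [mul_nonneg (show 0 ≤ p - α - t by omega) (show 0 ≤ α - 1 by omega),
          mul_nonneg (show 0 ≤ N - α by omega) (show 0 ≤ p - α by omega)]
      have e2 := mul_le_mul_of_nonneg_right e1 hq0.le
      have e3 := mul_nonneg (show 0 ≤ N by omega) (show (0 : ℤ) ≤ p - 1 by omega)
      linarith
    exact lt_of_mul_lt_mul_left (lt_of_mul_lt_mul_left (h2.trans_lt h3) (by omega)) hp0.le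
  -- The residue class of `r` modulo `p q`.
  have cop_pq : IsCoprime (p : ℤ) q :=
    Nat.isCoprime_iff_coprime.2 ((Nat.coprime_primes hp hq).2 hpq.ne)
  have cop_W : IsCoprime W (q : ℤ) := by
    refine (Prime.coprime_iff_not_dvd (Nat.prime_iff_prime_int.1 hq)).2 (fun h => ?_) |>.symm
    exact absurd (Int.le_of_dvd hWpos h) (by omega)
  have cop_ε : IsCoprime ε (q : ℤ) := ⟨ε, 0, by linear_combination hεε⟩
  obtain ⟨b, b', hb⟩ := (cop_pq.mul_left (cop_ε.mul_left cop_W))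
  obtain ⟨v, v', hv⟩ := id cop_pq
  set A : ℤ := ε * α * (v' * q) + b * (v * p) with hA
  have hAp : A * t = 1 + p * (ε * d + v * (b * t - ε * α * t)) := by
    rw [hA]
    linear_combination ε * α * t * hv + ε * hd + hεε
  have hAq : A * (p * (ε * W)) = 1 + q * (-b' + v' * (ε * α - b) * (p * (ε * W))) := by
    rw [hA]
    linear_combination b * (p * (ε * W)) * hv + hb
  obtain ⟨r, hrgt, hr, hrmod⟩ := Nat.forall_exists_prime_gt_and_zmodEq (q := p * q) (a := A)
    (p * q) (Nat.mul_ne_zero hp.ne_zero hq.ne_zero) (by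
      push_cast
      exact IsCoprime.mul_right
        ⟨t, -(ε * d + v * (b * t - ε * α * t)), by linear_combination hAp⟩
        ⟨p * (ε * W), -(-b' + v' * (ε * α - b) * (p * (ε * W))), by linear_combination hAq⟩)
  obtain ⟨f, hf⟩ := hrmod.dvd
  push_cast at hf
  have hqr : q < r := lt_of_le_of_lt (Nat.le_mul_of_pos_left q hp.pos) hrgt
  let D : TernaryDatum :=
    { p := p
      q := q
      r := r
      s := p - α
      t := t
      u := q - c
      w := ε * W
      prime_p := hp
      prime_q := hq
      prime_r := hr
      two_lt_p := hp2
      two_lt_q := hp2.trans hpq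
      p_ne_q := hpq.ne
      p_ne_r := (hpq.trans hqr).ne
      q_ne_r := hqr.ne
      s_pos := by omega
      s_lt := by omega
      u_pos := by omega
      u_lt := by omega
      bezout := by linear_combination hc
      t_pos := by omega
      t_lt := by omega
      t_inv := ⟨ε * d + v * (b * t - ε * α * t) - q * f * t, by linear_combination hAp - t * hf⟩
      w_inv := ⟨-b' + v' * (ε * α - b) * (p * (ε * W)) - p * f * (p * (ε * W)), by
        linear_combination hAq - p * (ε * W) * hf⟩ }
  refine ⟨D, W, rfl, rfl, hpq, hqr, ?_⟩
  exact { sign := hε, dvd := ⟨t - d, by linear_combination -hd⟩,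
          w_eq := by linear_combination W * hεε, s_add := by ring,
          t_add := htB, α_pos := hα, α_le := hαB, B_le := hBt, t_le := htα,
          lower := lower, upper := upper, range := range, r_ge := hrgt.le }

end TernaryDatum

theorem ncard_Icc_sub (p : ℕ) (t : ℤ) : (Set.Icc (t - p) t).ncard = p + 1 := by
  rw [← Finset.coe_Icc, Set.ncard_coe_finset, Int.card_Icc]
  omega

theorem height_eq_of_coeffSet_eq_Icc {n m : ℕ} {a : ℤ} (h : coeffSet n = Set.Icc (-a) m)
    (ham : a ≤ m) (hm : -a ≤ m) : height n = m := by
  have mem : ∀ k, (Polynomial.cyclotomic n ℤ).coeff k ∈ Set.Icc (-a) (m : ℤ) := fun k => by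
    rw [← h]; exact ⟨k, rfl⟩
  refine (isGreatest_height n).unique ⟨?_, ?_⟩
  · obtain ⟨k, hk⟩ : (m : ℤ) ∈ coeffSet n := by rw [h]; exact ⟨hm, le_rfl⟩
    refine ⟨k, ?_⟩
    simp only at hk ⊢
    rw [hk, Int.natAbs_natCast]
  · rintro _ ⟨k, rfl⟩
    have := mem k
    simp only [Set.mem_Icc] at this ⊢
    omega

/-- An optimal cyclotomic polynomial of height `t` exists if `t` has an inverse `±α` modulo `p`
in the right range. -/
theorem mem_optimalHeights_of_inverse {p t α : ℕ} (hp : p.Prime) (hp2 : 2 < p) {ε : ℤ}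
    (hε : ε = 1 ∨ ε = -1) (hα : 0 < α) (hαt : α + t ≤ p) (hpt : p ≤ 2 * t)
    (htα : 2 * t ≤ p + α) (hdvd : (p : ℤ) ∣ α * t - ε) : t ∈ optimalHeights := by
  obtain ⟨D, W, hDp, hDt, hpq, hqr, h⟩ := TernaryDatum.exists_isExtremal hp hp2 (t := t)
    (B := p - t) (α := α) hε (by ring) (by omega) (by omega) (by omega) (by omega) hdvd
  have hset := h.coeffSet_eq
  rw [hDt] at hset
  refine ⟨_, ⟨D.p, D.q, D.r, ⟨D.prime_p, D.prime_q, D.prime_r, D.two_lt_p, hpq, hqr⟩, rfl, ?_⟩,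
    height_eq_of_coeffSet_eq_Icc (a := p - t) ?_ (by omega) (by omega)⟩
  · rw [hset, ncard_Icc_sub]
  · rw [hset, hDp, neg_sub]

/-- The inverse required by `mem_optimalHeights_of_inverse` exists if `p ≥ 4 h² + 2 h + 3`,
where `h` is the distance of the height from `(p + 1) / 2`. With `g = 2 h + 1` one has
`2 t ≡ g` modulo `p`, so `α` is determined up to sign by `g α ≡ ± 2`. -/
theorem mem_optimalHeights_of_le {p h t : ℕ} (hp : p.Prime) (hp2 : 2 < p)
    (ht : 2 * t = p + 1 + 2 * h) (hh : 4 * h ^ 2 + 2 * h + 3 ≤ p) : t ∈ optimalHeights := by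
  have hp' : Prime (p : ℤ) := Nat.prime_iff_prime_int.1 hp
  have hodd := hp.odd_of_ne_two (by omega)
  have hcop : IsCoprime (t : ℤ) p := by
    refine ((Prime.coprime_iff_not_dvd hp').2 fun hd => ?_).symm
    have := Nat.le_of_dvd (by omega) (Int.natCast_dvd_natCast.1 hd)
    nlinarith
  obtain ⟨a, b, hab⟩ := hcop
  have hp0 : (0 : ℤ) < p := by exact_mod_cast hp.pos
  obtain ⟨α, ε, hε, h0, h1, hdvd⟩ : ∃ (α ε : ℤ), (ε = 1 ∨ ε = -1) ∧ 0 < α ∧ 2 * α < p ∧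
      (p : ℤ) ∣ α * t - ε := by
    have m0 := Int.emod_nonneg a hp0.ne'
    have m1 := Int.emod_lt_of_pos a hp0
    have m2 := Int.emod_add_mul_ediv a p
    have hd : (p : ℤ) ∣ (a % p) * t - 1 :=
      ⟨-(b + a / p * t), by linear_combination t * m2 + hab⟩
    have hne : a % p ≠ 0 := by
      intro h0
      rw [h0] at hd
      have := Int.le_of_dvd one_pos (by simpa using hd)
      omega
    obtain ⟨l, hl⟩ := hodd
    rcases lt_or_ge (2 * (a % p)) p with hlt | hge
    · exact ⟨a % p, 1, Or.inl rfl, by omega, hlt, hd⟩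
    · refine ⟨p - a % p, -1, Or.inr rfl, by omega, by omega, ?_⟩
      obtain ⟨x, hx⟩ := hd
      exact ⟨t - x, by linear_combination -hx⟩
  lift α to ℕ using h0.le
  obtain ⟨x, hx⟩ := hdvd
  have ht' : (2 * t : ℤ) = p + 1 + 2 * h := by exact_mod_cast ht
  have hh' : (4 * h ^ 2 + 2 * h + 3 : ℤ) ≤ p := by exact_mod_cast hh
  obtain ⟨k, hk⟩ : ∃ k : ℤ, (2 * h + 1) * α = k * p + 2 * ε :=
    ⟨2 * x - α, by linear_combination 2 * hx - α * ht'⟩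
  -- The lower bound `g ≤ α`.
  have hlow : (2 * h + 1 : ℤ) ≤ α := by
    rcases lt_trichotomy k 0 with hk0 | rfl | hk0
    · exfalso
      have h3 : k * p ≤ -1 * p := mul_le_mul_of_nonneg_right (by omega) hp0.le
      have h4 : 0 < (2 * h + 1 : ℤ) * α := mul_pos (by omega) h0
      rcases hε with rfl | rfl <;> omega
    · rcases Nat.eq_zero_or_pos h with rfl | hpos
      · simp; omega
      · exfalso
        have : (2 * h + 1 : ℤ) * α = 2 := by
          rcases hε with rfl | rfl
          · linarith
          · nlinarith
        have h3 : (2 * h + 1 : ℤ) ∣ 2 := ⟨α, this.symm⟩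
        have h4 := Int.le_of_dvd two_pos h3
        omega
    · by_contra hneg
      have h5 : (α : ℤ) ≤ 2 * h := by omega
      have h6 : (p : ℤ) - 2 ≤ k * p + 2 * ε := by
        rcases hε with rfl | rfl <;> nlinarith
      have h7 := mul_le_mul_of_nonneg_left h5 (show (0 : ℤ) ≤ 2 * h + 1 by omega)
      nlinarith
  -- The upper bound `α ≤ (p - g) / 2`.
  have hhigh : 2 * (α : ℤ) ≤ p - (2 * h + 1) := by
    by_contra hneg
    set d : ℤ := p - 2 * α with hd
    have hd1 : 0 < d := by omega
    have hd2 : d < 2 * h + 1 := by omega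
    obtain ⟨l, hl⟩ := hodd
    have hdodd : ∃ m, d = 2 * m + 1 := ⟨l - α, by omega⟩
    have hd3 : d ≤ 2 * h - 1 := by obtain ⟨m, hm⟩ := hdodd; omega
    have hdiv : (p : ℤ) ∣ (2 * h + 1) * d + 4 * ε :=
      ⟨2 * h + 1 - 2 * k, by rw [hd]; linear_combination -2 * hk⟩
    have hbound : (2 * h + 1) * d + 4 * ε < p ∧ -p < (2 * h + 1) * d + 4 * ε := by
      have : (2 * h + 1) * d ≤ (2 * h + 1) * (2 * h - 1) :=
        mul_le_mul_of_nonneg_left hd3 (by omega)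
      rcases hε with rfl | rfl <;> constructor <;> nlinarith
    have hz := Int.eq_zero_of_abs_lt_dvd hdiv (abs_lt.2 ⟨hbound.2, hbound.1⟩)
    obtain ⟨m, hm⟩ := hdodd
    rw [hm] at hz
    have : (2 * h + 1 : ℤ) * (2 * m + 1) = 2 * (2 * h * m + h + m) + 1 := by ring
    omega
  exact mem_optimalHeights_of_inverse hp hp2 hε (by omega) (by omega) (by omega) (by omega)
    ⟨x, hx⟩

/-! ### Progressions for `p = 7` -/

/-- The summand of Kaplan's formula for `p = 7` and `t = 5`. -/
def sevenDiff (s q u z x y : ℤ) : ℤ :=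
  truncCoeff 7 q s u z x y - truncCoeff 7 q s u z x ((y - 5) % 7)

/-- In an arithmetic progression modulo `q`, the second differences of the least residues
are `0` or `± q`. -/
theorem second_difference_emod {q : ℤ} (hq : 0 < q) (x w i d : ℤ) :
    (x - i * w) % q + (x - (i + 2 * d) * w) % q - 2 * ((x - (i + d) * w) % q) = 0 ∨
    (x - i * w) % q + (x - (i + 2 * d) * w) % q - 2 * ((x - (i + d) * w) % q) = q ∨
    (x - i * w) % q + (x - (i + 2 * d) * w) % q - 2 * ((x - (i + d) * w) % q) = -q := by
  have a1 := Int.emod_nonneg (x - i * w) hq.ne'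
  have a2 := Int.emod_lt_of_pos (x - i * w) hq
  have a3 := Int.emod_add_mul_ediv (x - i * w) q
  have b1 := Int.emod_nonneg (x - (i + 2 * d) * w) hq.ne'
  have b2 := Int.emod_lt_of_pos (x - (i + 2 * d) * w) hq
  have b3 := Int.emod_add_mul_ediv (x - (i + 2 * d) * w) q
  have c1 := Int.emod_nonneg (x - (i + d) * w) hq.ne'
  have c2 := Int.emod_lt_of_pos (x - (i + d) * w) hq
  have c3 := Int.emod_add_mul_ediv (x - (i + d) * w) q
  generalize (x - i * w) % q = a at *
  generalize (x - (i + 2 * d) * w) % q = b at *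
  generalize (x - (i + d) * w) % q = c at *
  generalize (x - i * w) / q = a' at *
  generalize (x - (i + 2 * d) * w) / q = b' at *
  generalize (x - (i + d) * w) / q = c' at *
  obtain ⟨m, hm⟩ : ∃ m, m = 2 * c' - a' - b' := ⟨_, rfl⟩
  have e : a + b - 2 * c = q * m := by subst hm; linarith
  have m1 : m < 2 := by
    by_contra h
    nlinarith [mul_le_mul_of_nonneg_left (not_lt.1 h) hq.le]
  have m2 : -2 < m := by
    by_contra h
    nlinarith [mul_le_mul_of_nonneg_left (not_lt.1 h) hq.le]
  interval_cases m <;> omega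

/-- For `s = 6`, `t = 5` and `p = 7`, no progression produces the coefficient `5`: the truncation
cannot fit both the summand with `y = 0` and the one with `y = 3`. The slope `30` is `s t`. -/
theorem not_sevenDiff_top_six {q u z x w y : ℤ} (hq : 0 < q) (hu : u * 7 + 6 * q = 7 * q + 1)
    (h : ∀ i : ℤ, 0 ≤ i → i < 7 → (y - i * 30) % 7 < 5 →
      sevenDiff 6 q u z ((x - i * w) % q) ((y - i * 30) % 7) = 1) : False := by
  have key : ∀ v : ℤ, 0 ≤ v → v < 5 →
      ∃ X, 0 ≤ X ∧ X < q ∧ sevenDiff 6 q u z X v = 1 := by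
    intro v h0 h1
    have e : (y - ((y - v) * 4 % 7) * 30) % 7 = v := by omega
    have := h ((y - v) * 4 % 7) (by omega) (by omega) (by omega)
    rw [e] at this
    exact ⟨_, Int.emod_nonneg _ hq.ne', Int.emod_lt_of_pos _ hq, this⟩
  obtain ⟨a, a1, a2, ha⟩ := key 0 (by norm_num) (by norm_num)
  obtain ⟨b, b1, b2, hb⟩ := key 3 (by norm_num) (by norm_num)
  norm_num [sevenDiff, truncCoeff] at ha hb
  split_ifs at ha hb <;> omega

/-- For `s = 1`, `t = 5` and `p = 7`, no progression produces the coefficient `-5`: the truncation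
cannot fit both the summand with `y = 1` and the one with `y = 4`. The slope `5` is `s t`. -/
theorem not_sevenDiff_bot_one {q u z x w y : ℤ} (hq : 0 < q) (hu : u * 7 + 1 * q = 7 * q + 1)
    (h : ∀ i : ℤ, 0 ≤ i → i < 7 → 1 ≤ (y - i * 5) % 7 → (y - i * 5) % 7 < 6 →
      sevenDiff 1 q u z ((x - i * w) % q) ((y - i * 5) % 7) = -1) : False := by
  have key : ∀ v : ℤ, 1 ≤ v → v < 6 →
      ∃ X, 0 ≤ X ∧ X < q ∧ sevenDiff 1 q u z X v = -1 := by
    intro v h0 h1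
    have e : (y - ((y - v) * 3 % 7) * 5) % 7 = v := by omega
    have := h ((y - v) * 3 % 7) (by omega) (by omega) (by omega) (by omega)
    rw [e] at this
    exact ⟨_, Int.emod_nonneg _ hq.ne', Int.emod_lt_of_pos _ hq, this⟩
  obtain ⟨a, a1, a2, ha⟩ := key 1 (by norm_num) (by norm_num)
  obtain ⟨b, b1, b2, hb⟩ := key 4 (by norm_num) (by norm_num)
  norm_num [sevenDiff, truncCoeff] at ha hb
  split_ifs at ha hb <;> omega

/-- For `s = 5`, `t = 5` and `p = 7`, no progression produces the coefficient `5`. The truncation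
confines the first coordinates, and in each case the second differences of the progression
of first coordinates yield a contradiction. The slope `25` is `s t`. -/
theorem not_sevenDiff_top_five {q u z x w y : ℤ} (hq : 0 < q) (hu : u * 7 + 5 * q = 7 * q + 1)
    (h : ∀ i : ℤ, 0 ≤ i → i < 7 → (y - i * 25) % 7 < 5 →
      sevenDiff 5 q u z ((x - i * w) % q) ((y - i * 25) % 7) = 1) : False := by
  have sd := second_difference_emod hq x w
  have pos : ∀ i : ℤ, 0 ≤ (x - i * w) % q := fun i => Int.emod_nonneg _ hq.ne'
  have lt : ∀ i : ℤ, (x - i * w) % q < q := fun i => Int.emod_lt_of_pos _ hq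
  have fact : ∀ i v : ℤ, 0 ≤ i → i < 7 → (y - i * 25) % 7 = v → v < 5 →
      sevenDiff 5 q u z ((x - i * w) % q) v = 1 := by
    rintro i v h0 h1 rfl h2
    exact h i h0 h1 h2
  generalize hX : (fun i : ℤ => (x - i * w) % q) = X at *
  have hX' : ∀ i, (x - i * w) % q = X i := fun i => by rw [← hX]
  simp only [hX'] at sd pos lt fact
  have f0 : ∀ X, sevenDiff 5 q u z X 0 = 1 → X < u ∧ 7 * X ≤ z ∧ z < 7 * X + 2 * q := by
    intro X hX
    norm_num [sevenDiff, truncCoeff] at hX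
    split_ifs at hX <;> omega
  have f1 : ∀ X, sevenDiff 5 q u z X 1 = 1 → X < u ∧ 7 * X + q ≤ z ∧ z < 7 * X + 3 * q := by
    intro X hX
    norm_num [sevenDiff, truncCoeff] at hX
    split_ifs at hX <;> omega
  have f2 : ∀ X, sevenDiff 5 q u z X 2 = 1 → X < u ∧ 7 * X + 2 * q ≤ z ∧ z < 7 * X + 4 * q := by
    intro X hX
    norm_num [sevenDiff, truncCoeff] at hX
    split_ifs at hX <;> omega
  have f3 : ∀ X, sevenDiff 5 q u z X 3 = 1 →
      (X < u ∧ 7 * X + 3 * q ≤ z) ∨ (u ≤ X ∧ 7 * X - 2 * q ≤ z) := by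
    intro X hX
    norm_num [sevenDiff, truncCoeff] at hX
    split_ifs at hX <;> omega
  have f4 : ∀ X, sevenDiff 5 q u z X 4 = 1 →
      (X < u ∧ 7 * X + 4 * q ≤ z) ∨ (u ≤ X ∧ 7 * X - q ≤ z) := by
    intro X hX
    norm_num [sevenDiff, truncCoeff] at hX
    split_ifs at hX <;> omega
  -- The residues `1`, `4`, `0` cannot occur in succession.
  have c1 : ∀ i, 0 ≤ i → i < 5 → (y - i * 25) % 7 = 1 → False := by
    intro i h0 h1 hi
    have g1 := f1 _ (fact i 1 h0 (by omega) hi (by norm_num))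
    have g4 := f4 _ (fact (i + 1) 4 (by omega) (by omega) (by omega) (by norm_num))
    have g0 := f0 _ (fact (i + 2 * 1) 0 (by omega) (by omega) (by omega) (by norm_num))
    have := sd i 1
    have := pos i
    have := pos (i + 1)
    have := pos (i + 2 * 1)
    omega
  have hy : y % 7 = 0 ∨ y % 7 = 4 ∨ y % 7 = 1 ∨ y % 7 = 2 ∨ y % 7 = 3 ∨ y % 7 = 5 ∨
    y % 7 = 6 := by omega
  rcases hy with hy | hy | hy | hy | hy | hy | hy
  · have g0 := f0 _ (fact 0 0 (by omega) (by omega) (by omega) (by norm_num))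
    have g2 := f2 _ (fact 3 2 (by omega) (by omega) (by omega) (by norm_num))
    have g4 := f4 _ (fact 6 4 (by omega) (by omega) (by omega) (by norm_num))
    have := sd 0 3
    have := pos 0
    have := pos 3
    have := pos 6
    have := lt 6
    norm_num at *
    omega
  · have g4 := f4 _ (fact 0 4 (by omega) (by omega) (by omega) (by norm_num))
    have g0 := f0 _ (fact 1 0 (by omega) (by omega) (by omega) (by norm_num))
    have g3 := f3 _ (fact 2 3 (by omega) (by omega) (by omega) (by norm_num))
    have g2 := f2 _ (fact 4 2 (by omega) (by omega) (by omega) (by norm_num))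
    have s1 := sd 0 1
    have s2 := sd 0 2
    have p0 := pos 0
    have p1 := pos 1
    have p2 := pos 2
    have p4 := pos 4
    have l0 := lt 0
    have l2 := lt 2
    norm_num at s1 s2
    omega
  · exact c1 0 (by omega) (by omega) (by omega)
  · exact c1 2 (by omega) (by omega) (by omega)
  · exact c1 4 (by omega) (by omega) (by omega)
  · exact c1 1 (by omega) (by omega) (by omega)
  · exact c1 3 (by omega) (by omega) (by omega)

/-- For `s = 2`, `t = 5` and `p = 7`, no progression produces the coefficient `-5`, for the same
reason as in `not_sevenDiff_top_five`. The slope `10` is `s t`. -/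
theorem not_sevenDiff_bot_two {q u z x w y : ℤ} (hq : 0 < q) (hu : u * 7 + 2 * q = 7 * q + 1)
    (h : ∀ i : ℤ, 0 ≤ i → i < 7 → 2 ≤ (y - i * 10) % 7 → (y - i * 10) % 7 < 7 →
      sevenDiff 2 q u z ((x - i * w) % q) ((y - i * 10) % 7) = -1) : False := by
  have sd := second_difference_emod hq x w
  have pos : ∀ i : ℤ, 0 ≤ (x - i * w) % q := fun i => Int.emod_nonneg _ hq.ne'
  have lt : ∀ i : ℤ, (x - i * w) % q < q := fun i => Int.emod_lt_of_pos _ hq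
  have fact : ∀ i v : ℤ, 0 ≤ i → i < 7 → (y - i * 10) % 7 = v → 2 ≤ v →
      sevenDiff 2 q u z ((x - i * w) % q) v = -1 := by
    rintro i v h0 h1 rfl h2
    exact h i h0 h1 h2 (by omega)
  generalize hX : (fun i : ℤ => (x - i * w) % q) = X at *
  have hX' : ∀ i, (x - i * w) % q = X i := fun i => by rw [← hX]
  simp only [hX'] at sd pos lt fact
  have f2 : ∀ X, sevenDiff 2 q u z X 2 = -1 → u ≤ X ∧ 7 * X - 5 * q ≤ z ∧ z < 7 * X - 3 * q := by
    intro X hX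
    norm_num [sevenDiff, truncCoeff] at hX
    split_ifs at hX <;> omega
  have f3 : ∀ X, sevenDiff 2 q u z X 3 = -1 → u ≤ X ∧ 7 * X - 4 * q ≤ z ∧ z < 7 * X - 2 * q := by
    intro X hX
    norm_num [sevenDiff, truncCoeff] at hX
    split_ifs at hX <;> omega
  have f4 : ∀ X, sevenDiff 2 q u z X 4 = -1 → u ≤ X ∧ 7 * X - 3 * q ≤ z ∧ z < 7 * X - 1 * q := by
    intro X hX
    norm_num [sevenDiff, truncCoeff] at hX
    split_ifs at hX <;> omega
  have f5 : ∀ X, sevenDiff 2 q u z X 5 = -1 →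
      (u ≤ X ∧ 7 * X - 2 * q ≤ z) ∨ (X < u ∧ 7 * X ≤ z) := by
    intro X hX
    norm_num [sevenDiff, truncCoeff] at hX
    split_ifs at hX <;> omega
  have f6 : ∀ X, sevenDiff 2 q u z X 6 = -1 →
      (u ≤ X ∧ 7 * X - q ≤ z) ∨ (X < u ∧ 7 * X + q ≤ z) := by
    intro X hX
    norm_num [sevenDiff, truncCoeff] at hX
    split_ifs at hX <;> omega
  -- The residues `2`, `6`, `3` cannot occur in succession.
  have c1 : ∀ i, 0 ≤ i → i < 5 → (y - i * 10) % 7 = 2 → False := by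
    intro i h0 h1 hi
    have g2 := f2 _ (fact i 2 h0 (by omega) hi (by norm_num))
    have g6 := f6 _ (fact (i + 1) 6 (by omega) (by omega) (by omega) (by norm_num))
    have g3 := f3 _ (fact (i + 2 * 1) 3 (by omega) (by omega) (by omega) (by norm_num))
    have := sd i 1
    have := lt i
    have := pos (i + 1)
    have := lt (i + 1)
    have := lt (i + 2 * 1)
    omega
  have hy : y % 7 = 6 ∨ y % 7 = 3 ∨ y % 7 = 0 ∨ y % 7 = 1 ∨ y % 7 = 2 ∨ y % 7 = 4 ∨
    y % 7 = 5 := by omega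
  rcases hy with hy | hy | hy | hy | hy | hy | hy
  · have g6 := f6 _ (fact 0 6 (by omega) (by omega) (by omega) (by norm_num))
    have g4 := f4 _ (fact 3 4 (by omega) (by omega) (by omega) (by norm_num))
    have g2 := f2 _ (fact 6 2 (by omega) (by omega) (by omega) (by norm_num))
    have s1 := sd 0 3
    have p0 := pos 0
    have l0 := lt 0
    have l3 := lt 3
    have l6 := lt 6
    norm_num at s1
    omega
  · have g5 := f5 _ (fact 4 5 (by omega) (by omega) (by omega) (by norm_num))
    have g4 := f4 _ (fact 2 4 (by omega) (by omega) (by omega) (by norm_num))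
    have g2 := f2 _ (fact 5 2 (by omega) (by omega) (by omega) (by norm_num))
    have g6 := f6 _ (fact 6 6 (by omega) (by omega) (by omega) (by norm_num))
    have s1 := sd 2 2
    have s2 := sd 4 1
    have p4 := pos 4
    have p6 := pos 6
    have l4 := lt 4
    have l6 := lt 6
    have l2 := lt 2
    have l5 := lt 5
    norm_num at s1 s2
    omega
  · exact c1 4 (by omega) (by omega) (by omega)
  · exact c1 2 (by omega) (by omega) (by omega)
  · exact c1 0 (by omega) (by omega) (by omega)
  · exact c1 3 (by omega) (by omega) (by omega)
  · exact c1 1 (by omega) (by omega) (by omega)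

/-! ### The heights `1` and `5` are not optimal -/

theorem exists_inverse_mod {a p : ℤ} (hp : 1 < p) (h : IsCoprime a p) :
    ∃ s, 0 < s ∧ s < p ∧ p ∣ a * s - 1 := by
  obtain ⟨b, c, hbc⟩ := h
  have h0 := Int.emod_nonneg b (by omega : p ≠ 0)
  have h1 := Int.emod_lt_of_pos b (by omega : 0 < p)
  have h2 := Int.emod_add_mul_ediv b p
  have hd : p ∣ a * (b % p) - 1 := ⟨-(c + a * (b / p)), by linear_combination a * h2 + hbc⟩
  refine ⟨b % p, lt_of_le_of_ne h0 fun h => ?_, h1, hd⟩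
  rw [← h] at hd
  have := Int.le_of_dvd one_pos (by simpa using hd)
  omega

namespace TernaryDatum

/-- The remaining inverses `u` and `w` of a `TernaryDatum` always exist. -/
theorem exists_of_inverses {p q r : ℕ} (hp : p.Prime) (hq : q.Prime) (hr : r.Prime)
    (hp2 : 2 < p) (hq2 : 2 < q) (hpq : p ≠ q) (hpr : p ≠ r) (hqr : q ≠ r) {s t : ℤ}
    (hs0 : 0 < s) (hs1 : s < p) (hs : (p : ℤ) ∣ q * s - 1) (ht0 : 0 < t) (ht1 : t < p)
    (ht : (p : ℤ) ∣ r * t - 1) :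
    ∃ D : TernaryDatum, D.p = p ∧ D.q = q ∧ D.r = r ∧ D.s = s ∧ D.t = t := by
  have hp0 : (0 : ℤ) < p := by exact_mod_cast hp.pos
  have hq0 : (2 : ℤ) < q := by exact_mod_cast hq2
  have cop : ∀ {a b : ℕ}, a.Prime → b.Prime → a ≠ b → IsCoprime (a : ℤ) b := fun ha hb hab =>
    Nat.isCoprime_iff_coprime.2 ((Nat.coprime_primes ha hb).2 hab)
  obtain ⟨w, -, -, hw⟩ := exists_inverse_mod (a := r * p) (p := q) (by omega)
    ((cop hr hq hqr.symm).mul_left (cop hp hq hpq))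
  obtain ⟨c, hc⟩ := hs
  have hcpos : 0 < c := by
    have h1 : (q : ℤ) ≤ q * s := by nlinarith
    exact pos_of_mul_pos_right (by linarith : 0 < (p : ℤ) * c) hp0.le
  have hcq : c < q := by
    have h1 : (q : ℤ) * s < q * p := mul_lt_mul_of_pos_left hs1 (by omega)
    exact lt_of_mul_lt_mul_left (by linarith : (p : ℤ) * c < p * q) hp0.le
  exact ⟨{ p := p
           q := q
           r := r
           s := s
           t := t
           u := q - c
           w := w
           prime_p := hp
           prime_q := hq
           prime_r := hr
           two_lt_p := hp2
           two_lt_q := hq2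
           p_ne_q := hpq
           p_ne_r := hpr
           q_ne_r := hqr
           s_pos := hs0
           s_lt := hs1
           u_pos := by omega
           u_lt := by omega
           bezout := by linear_combination hc
           t_pos := ht0
           t_lt := ht1
           t_inv := ht
           w_inv := hw }, rfl, rfl, rfl, rfl, rfl⟩

/-- After exchanging `q` and `r` if necessary, `s` is at least as close as `t` to a multiple
of `p`. -/
theorem exists_of_isTernaryTriple {p q r : ℕ} (h : IsTernaryTriple p q r) :
    ∃ D : TernaryDatum, D.p = p ∧ D.p * D.q * D.r = p * q * r ∧
      ((D.p - D.s ≤ D.t ∧ D.p - D.s ≤ D.p - D.t) ∨ (D.s ≤ D.t ∧ D.s ≤ D.p - D.t)) := by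
  obtain ⟨hp, hq, hr, hp2, hpq, hqr⟩ := h
  have hp1 : (1 : ℤ) < p := by exact_mod_cast hp.one_lt
  have cop : ∀ {a b : ℕ}, a.Prime → b.Prime → a ≠ b → IsCoprime (a : ℤ) b := fun ha hb hab =>
    Nat.isCoprime_iff_coprime.2 ((Nat.coprime_primes ha hb).2 hab)
  obtain ⟨s, hs0, hs1, hs⟩ := exists_inverse_mod hp1 (cop hq hp hpq.ne')
  obtain ⟨t, ht0, ht1, ht⟩ := exists_inverse_mod hp1 (cop hr hp (hpq.trans hqr).ne')
  by_cases hle : (p - s ≤ t ∧ p - s ≤ p - t) ∨ (s ≤ t ∧ s ≤ p - t)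
  · obtain ⟨D, rfl, rfl, rfl, rfl, rfl⟩ := exists_of_inverses hp hq hr hp2 (hp2.trans hpq) hpq.ne
      (hpq.trans hqr).ne hqr.ne hs0 hs1 hs ht0 ht1 ht
    exact ⟨D, rfl, rfl, hle⟩
  · obtain ⟨D, rfl, rfl, rfl, rfl, rfl⟩ := exists_of_inverses hp hr hq hp2
      (hp2.trans (hpq.trans hqr)) (hpq.trans hqr).ne hpq.ne hqr.ne' ht0 ht1 ht hs0 hs1 hs
    exact ⟨D, rfl, by ring, by omega⟩

variable (D : TernaryDatum)

theorem eq_of_sum_eq {n : ℕ} {f g : ℕ → ℤ} (h : ∀ i ∈ Finset.range n, f i ≤ g i)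
    (hsum : ∑ i ∈ Finset.range n, f i = ∑ i ∈ Finset.range n, g i) (i : ℕ) (hi : i < n) :
    f i = g i :=
  (Finset.sum_eq_sum_iff_of_le h).1 hsum i (Finset.mem_range.2 hi)

/-- If the coefficient at `k` is the largest one allowed by `coeff_mem_Icc_of_sub_s_le`, all
summands of Kaplan's formula are as large as possible. The next three statements are the
analogues for the other extreme coefficients. -/
theorem sliceDiff_eq_of_coeff_eq_t (h1 : D.p - D.s ≤ D.t) (h2 : D.p - D.s ≤ D.p - D.t) {k : ℕ}
    (hk : (Polynomial.cyclotomic (D.p * D.q * D.r) ℤ).coeff k = D.t) : ∀ i : ℕ, i < D.p →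
    D.sliceDiff (k / D.r) (((k : ℤ) - i) * D.w % D.q) (((k : ℤ) - i) * (D.s * D.t) % D.p) =
      if 0 ≤ ((k : ℤ) - i) * (D.s * D.t) % D.p ∧ ((k : ℤ) - i) * (D.s * D.t) % D.p < D.t
      then 1 else 0 := by
  refine eq_of_sum_eq (fun i _ => (D.sliceDiff_of_sub_s_le h1 h2
    (Int.emod_nonneg _ D.p_pos.ne') (Int.emod_lt_of_pos _ D.p_pos)).1) ?_
  rw [← coeff_eq_sum_sliceDiff, hk]
  have c1 := sum_ite_affine_mod D.prime_p.pos D.isCoprime_s_mul_t (k * (D.s * D.t)) 0 D.t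
    le_rfl D.t_pos.le D.t_lt.le
  simp only [← sub_mul] at c1
  rw [c1, sub_zero]

theorem sliceDiff_eq_of_coeff_eq_t_sub_p (h1 : D.p - D.s ≤ D.t) (h2 : D.p - D.s ≤ D.p - D.t)
    {k : ℕ} (hk : (Polynomial.cyclotomic (D.p * D.q * D.r) ℤ).coeff k = D.t - D.p) :
    ∀ i : ℕ, i < D.p →
    -(if D.t ≤ ((k : ℤ) - i) * (D.s * D.t) % D.p ∧ ((k : ℤ) - i) * (D.s * D.t) % D.p < D.p
      then 1 else 0) =
    D.sliceDiff (k / D.r) (((k : ℤ) - i) * D.w % D.q) (((k : ℤ) - i) * (D.s * D.t) % D.p) := by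
  refine eq_of_sum_eq (f := fun i : ℕ => -(if D.t ≤ ((k : ℤ) - i) * (D.s * D.t) % D.p ∧
    ((k : ℤ) - i) * (D.s * D.t) % D.p < D.p then 1 else 0)) (fun i _ =>
    (D.sliceDiff_of_sub_s_le h1 h2
    (Int.emod_nonneg _ D.p_pos.ne') (Int.emod_lt_of_pos _ D.p_pos)).2) ?_
  rw [← coeff_eq_sum_sliceDiff, hk, Finset.sum_neg_distrib]
  have c1 := sum_ite_affine_mod D.prime_p.pos D.isCoprime_s_mul_t (k * (D.s * D.t)) D.t D.p
    D.t_pos.le D.t_lt.le le_rfl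
  simp only [← sub_mul] at c1
  rw [c1, neg_sub]

theorem sliceDiff_eq_of_coeff_eq_p_sub_t (h1 : D.s ≤ D.t) (h2 : D.s ≤ D.p - D.t) {k : ℕ}
    (hk : (Polynomial.cyclotomic (D.p * D.q * D.r) ℤ).coeff k = D.p - D.t) :
    ∀ i : ℕ, i < D.p →
    D.sliceDiff (k / D.r) (((k : ℤ) - i) * D.w % D.q) (((k : ℤ) - i) * (D.s * D.t) % D.p) =
    1 - (if D.s ≤ ((k : ℤ) - i) * (D.s * D.t) % D.p ∧
      ((k : ℤ) - i) * (D.s * D.t) % D.p < D.s + D.t then 1 else 0) := by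
  refine eq_of_sum_eq (g := fun i : ℕ => 1 - (if D.s ≤ ((k : ℤ) - i) * (D.s * D.t) % D.p ∧
    ((k : ℤ) - i) * (D.s * D.t) % D.p < D.s + D.t then 1 else 0)) (fun i _ =>
    (D.sliceDiff_of_s_le h1 h2
    (Int.emod_nonneg _ D.p_pos.ne') (Int.emod_lt_of_pos _ D.p_pos)).1) ?_
  rw [← coeff_eq_sum_sliceDiff, hk, Finset.sum_sub_distrib]
  have c := sum_ite_affine_mod D.prime_p.pos D.isCoprime_s_mul_t (k * (D.s * D.t)) D.s
    (D.s + D.t) D.s_pos.le (by linarith [D.t_pos]) (by linarith)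
  simp only [← sub_mul, add_sub_cancel_left] at c
  rw [c, Finset.sum_const, Finset.card_range, nsmul_eq_mul, mul_one]

theorem sliceDiff_eq_of_coeff_eq_neg_t (h1 : D.s ≤ D.t) (h2 : D.s ≤ D.p - D.t) {k : ℕ}
    (hk : (Polynomial.cyclotomic (D.p * D.q * D.r) ℤ).coeff k = -D.t) :
    ∀ i : ℕ, i < D.p →
    -(if D.s ≤ ((k : ℤ) - i) * (D.s * D.t) % D.p ∧
      ((k : ℤ) - i) * (D.s * D.t) % D.p < D.s + D.t then 1 else 0) =
    D.sliceDiff (k / D.r) (((k : ℤ) - i) * D.w % D.q) (((k : ℤ) - i) * (D.s * D.t) % D.p) := by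
  refine eq_of_sum_eq (f := fun i : ℕ => -(if D.s ≤ ((k : ℤ) - i) * (D.s * D.t) % D.p ∧
    ((k : ℤ) - i) * (D.s * D.t) % D.p < D.s + D.t then 1 else 0)) (fun i _ =>
    (D.sliceDiff_of_s_le h1 h2
    (Int.emod_nonneg _ D.p_pos.ne') (Int.emod_lt_of_pos _ D.p_pos)).2) ?_
  rw [← coeff_eq_sum_sliceDiff, hk, Finset.sum_neg_distrib]
  have c := sum_ite_affine_mod D.prime_p.pos D.isCoprime_s_mul_t (k * (D.s * D.t)) D.s
    (D.s + D.t) D.s_pos.le (by linarith [D.t_pos]) (by linarith)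
  simp only [← sub_mul, add_sub_cancel_left] at c
  rw [c]

/-- For `t = 2` and `t = 5` the summands of Kaplan's formula differ by a shift and a sign. -/
theorem sub_eq_neg_sevenDiff {q s u z x y y' : ℤ} (hy0 : 0 ≤ y) (hy1 : y < 7)
    (hy' : y' = (y - 2) % 7) :
    truncCoeff 7 q s u z x y - truncCoeff 7 q s u z x ((y - 2) % 7) =
      -sevenDiff s q u z x y' := by
  rw [sevenDiff, hy', show ((y - 2) % 7 - 5) % 7 = y by omega]
  ring

theorem sub_two_emod_seven {a b c : ℤ} (h : a = b - 2 + 7 * c) : a % 7 = (b % 7 - 2) % 7 := by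
  omega

theorem two_le_emod_seven {b : ℤ} (h : (b % 7 - 2) % 7 < 5) : 2 ≤ b % 7 ∧ b % 7 < 7 := by
  omega

theorem not_between_emod_seven {b s : ℤ} (h : s ≤ (b % 7 - 2) % 7)
    (h' : (b % 7 - 2) % 7 < s + 5) : ¬ (s ≤ b % 7 ∧ b % 7 < s + 2) := by
  omega

/-- If `p = 7` and the interval of `coeff_mem_Icc_of_sub_s_le` has an end point `5` or `-5`, this
end point is not a coefficient. The case `t = 2` is reduced to the one of `t = 5` by traversing
the progression backwards. -/
theorem coeff_ne_of_sub_s_le (hp : D.p = 7) (h1 : D.p - D.s ≤ D.t) (h2 : D.p - D.s ≤ D.p - D.t)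
    (h25 : D.t = 2 ∨ D.t = 5) (k : ℕ) :
    |(Polynomial.cyclotomic (D.p * D.q * D.r) ℤ).coeff k| ≠ 5 := by
  have hp7 : (D.p : ℤ) = 7 := by rw [hp]; rfl
  have hb := D.bezout
  have hs1 := D.s_lt
  have ht0 := D.t_pos
  have ht1 := D.t_lt
  have hb' := D.coeff_mem_Icc_of_sub_s_le h1 h2 k
  intro habs
  rw [Set.mem_Icc, hp7] at hb'
  have e5 := D.sliceDiff_eq_of_coeff_eq_t h1 h2 (k := k)
  have e2 := D.sliceDiff_eq_of_coeff_eq_t_sub_p h1 h2 (k := k)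
  have hk : D.t = 5 ∧ (Polynomial.cyclotomic (D.p * D.q * D.r) ℤ).coeff k = D.t ∨
      D.t = 2 ∧ (Polynomial.cyclotomic (D.p * D.q * D.r) ℤ).coeff k = D.t - D.p := by
    rcases (abs_eq (by norm_num)).1 habs with h | h <;> omega
  simp only [sliceDiff, hp7] at h1 h2 hb hs1 ht1 e5 e2
  rcases hk with ⟨ht, hk⟩ | ⟨ht, hk⟩
  · have key := e5 (by rw [hk])
    rw [ht] at key h1 h2
    rcases (by omega : D.s = 5 ∨ D.s = 6) with hs | hs
    all_goals rw [hs] at key hb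
    · refine not_sevenDiff_top_five D.q_pos hb (z := k / D.r) (x := k * D.w) (w := D.w)
        (y := k * 25) fun i hi0 hi1 hi => ?_
      lift i to ℕ using hi0
      rw [← sub_mul] at hi ⊢
      rw [← sub_mul]
      have := key i (by omega)
      rwa [show (5 * 5 : ℤ) = 25 by norm_num,
        if_pos ⟨Int.emod_nonneg _ (by norm_num), hi⟩] at this
    · refine not_sevenDiff_top_six D.q_pos hb (z := k / D.r) (x := k * D.w) (w := D.w)
        (y := k * 30) fun i hi0 hi1 hi => ?_
      lift i to ℕ using hi0
      rw [← sub_mul] at hi ⊢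
      rw [← sub_mul]
      have := key i (by omega)
      rwa [show (6 * 5 : ℤ) = 30 by norm_num,
        if_pos ⟨Int.emod_nonneg _ (by norm_num), hi⟩] at this
  · have key := e2 (by rw [hk, hp7])
    rw [ht] at key h1 h2
    rcases (by omega : D.s = 5 ∨ D.s = 6) with hs | hs
    all_goals rw [hs] at key hb
    · refine not_sevenDiff_top_five D.q_pos hb (z := k / D.r) (x := (k - 6) * D.w) (w := -D.w)
        (y := (k - 6) * 10 - 2) fun i hi0 hi1 hi => ?_
      obtain ⟨j, hj⟩ := Int.eq_ofNat_of_zero_le (show 0 ≤ 6 - i by omega)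
      obtain rfl : i = 6 - j := by omega
      have := key j (by omega)
      have e := sub_two_emod_seven (a := (k - 6) * 10 - 2 - (6 - j) * 25)
        (b := (k - j) * (5 * 2)) (c := 5 * j - 30) (by ring)
      rw [sub_eq_neg_sevenDiff (Int.emod_nonneg _ (by norm_num))
        (Int.emod_lt_of_pos _ (by norm_num)) e, if_pos (two_le_emod_seven (by rwa [← e]))] at this
      rw [show (k - 6) * D.w - (6 - j) * -D.w = (k - j) * D.w by ring]
      exact (neg_inj.1 this).symm
    · refine not_sevenDiff_top_six D.q_pos hb (z := k / D.r) (x := (k - 6) * D.w) (w := -D.w)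
        (y := (k - 6) * 12 - 2) fun i hi0 hi1 hi => ?_
      obtain ⟨j, hj⟩ := Int.eq_ofNat_of_zero_le (show 0 ≤ 6 - i by omega)
      obtain rfl : i = 6 - j := by omega
      have := key j (by omega)
      have e := sub_two_emod_seven (a := (k - 6) * 12 - 2 - (6 - j) * 30)
        (b := (k - j) * (6 * 2)) (c := 6 * j - 36) (by ring)
      rw [sub_eq_neg_sevenDiff (Int.emod_nonneg _ (by norm_num))
        (Int.emod_lt_of_pos _ (by norm_num)) e, if_pos (two_le_emod_seven (by rwa [← e]))] at this
      rw [show (k - 6) * D.w - (6 - j) * -D.w = (k - j) * D.w by ring]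
      exact (neg_inj.1 this).symm

/-- The analogue of `coeff_ne_of_sub_s_le` for the interval of `coeff_mem_Icc_of_s_le`. -/
theorem coeff_ne_of_s_le (hp : D.p = 7) (h1 : D.s ≤ D.t) (h2 : D.s ≤ D.p - D.t)
    (h25 : D.t = 2 ∨ D.t = 5) (k : ℕ) :
    |(Polynomial.cyclotomic (D.p * D.q * D.r) ℤ).coeff k| ≠ 5 := by
  have hp7 : (D.p : ℤ) = 7 := by rw [hp]; rfl
  have hb := D.bezout
  have hs0 := D.s_pos
  have ht0 := D.t_pos
  have ht1 := D.t_lt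
  have hb' := D.coeff_mem_Icc_of_s_le h1 h2 k
  intro habs
  rw [Set.mem_Icc, hp7] at hb'
  have e5 := D.sliceDiff_eq_of_coeff_eq_neg_t h1 h2 (k := k)
  have e2 := D.sliceDiff_eq_of_coeff_eq_p_sub_t h1 h2 (k := k)
  have hk : D.t = 5 ∧ (Polynomial.cyclotomic (D.p * D.q * D.r) ℤ).coeff k = -D.t ∨
      D.t = 2 ∧ (Polynomial.cyclotomic (D.p * D.q * D.r) ℤ).coeff k = D.p - D.t := by
    rcases (abs_eq (by norm_num)).1 habs with h | h <;> omega
  simp only [sliceDiff, hp7] at h1 h2 hb ht1 e5 e2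
  rcases hk with ⟨ht, hk⟩ | ⟨ht, hk⟩
  · have key := e5 (by rw [hk])
    rw [ht] at key h1 h2
    rcases (by omega : D.s = 1 ∨ D.s = 2) with hs | hs
    all_goals rw [hs] at key hb
    · refine not_sevenDiff_bot_one D.q_pos hb (z := k / D.r) (x := k * D.w) (w := D.w)
        (y := k * 5) fun i hi0 hi1 hi hi' => ?_
      lift i to ℕ using hi0
      rw [← sub_mul] at hi hi' ⊢
      rw [← sub_mul]
      have := key i (by omega)
      rw [show (1 * 5 : ℤ) = 5 by norm_num, if_pos ⟨hi, by omega⟩] at this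
      exact this.symm
    · refine not_sevenDiff_bot_two D.q_pos hb (z := k / D.r) (x := k * D.w) (w := D.w)
        (y := k * 10) fun i hi0 hi1 hi hi' => ?_
      lift i to ℕ using hi0
      rw [← sub_mul] at hi hi' ⊢
      rw [← sub_mul]
      have := key i (by omega)
      rw [show (2 * 5 : ℤ) = 10 by norm_num, if_pos ⟨hi, by omega⟩] at this
      exact this.symm
  · have key := e2 (by rw [hk, hp7])
    rw [ht] at key h1 h2
    rcases (by omega : D.s = 1 ∨ D.s = 2) with hs | hs
    all_goals rw [hs] at key hb
    · refine not_sevenDiff_bot_one D.q_pos hb (z := k / D.r) (x := (k - 6) * D.w) (w := -D.w)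
        (y := (k - 6) * 2 - 2) fun i hi0 hi1 hi hi' => ?_
      obtain ⟨j, hj⟩ := Int.eq_ofNat_of_zero_le (show 0 ≤ 6 - i by omega)
      obtain rfl : i = 6 - j := by omega
      have := key j (by omega)
      have e := sub_two_emod_seven (a := (k - 6) * 2 - 2 - (6 - j) * 5)
        (b := (k - j) * (1 * 2)) (c := j - 6) (by ring)
      rw [sub_eq_neg_sevenDiff (Int.emod_nonneg _ (by norm_num))
        (Int.emod_lt_of_pos _ (by norm_num)) e, if_neg (not_between_emod_seven
        (by rwa [← e]) (by rw [← e]; exact hi'))] at this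
      rw [show (k - 6) * D.w - (6 - j) * -D.w = (k - j) * D.w by ring]
      linarith
    · refine not_sevenDiff_bot_two D.q_pos hb (z := k / D.r) (x := (k - 6) * D.w) (w := -D.w)
        (y := (k - 6) * 4 - 2) fun i hi0 hi1 hi hi' => ?_
      obtain ⟨j, hj⟩ := Int.eq_ofNat_of_zero_le (show 0 ≤ 6 - i by omega)
      obtain rfl : i = 6 - j := by omega
      have := key j (by omega)
      have e := sub_two_emod_seven (a := (k - 6) * 4 - 2 - (6 - j) * 10)
        (b := (k - j) * (2 * 2)) (c := 2 * j - 12) (by ring)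
      rw [sub_eq_neg_sevenDiff (Int.emod_nonneg _ (by norm_num))
        (Int.emod_lt_of_pos _ (by norm_num)) e, if_neg (not_between_emod_seven
        (by rwa [← e]) (by rw [← e]; exact hi'))] at this
      rw [show (k - 6) * D.w - (6 - j) * -D.w = (k - j) * D.w by ring]
      linarith

end TernaryDatum

/-- Every coefficient set lies in an interval `[-b, p - b]` with `0 < b < p`. If `p = 7` and this
interval has an end point `5` or `-5`, the end point is not a coefficient. -/
theorem exists_coeffSet_subset_Icc {p q r : ℕ} (h : IsTernaryTriple p q r) :
    ∃ b : ℤ, 0 < b ∧ b < p ∧ coeffSet (p * q * r) ⊆ Set.Icc (-b) (p - b) ∧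
      (p = 7 → b = 2 ∨ b = 5 → ∀ a ∈ coeffSet (p * q * r), |a| ≠ 5) := by
  obtain ⟨D, rfl, hD, hst | hst⟩ := TernaryDatum.exists_of_isTernaryTriple h
  · refine ⟨D.p - D.t, by linarith [D.t_lt], by linarith [D.t_pos], ?_, fun h7 h25 => ?_⟩
    · rintro _ ⟨k, rfl⟩
      rw [← hD, neg_sub, sub_sub_cancel]
      exact D.coeff_mem_Icc_of_sub_s_le hst.1 hst.2 k
    · rintro _ ⟨k, rfl⟩
      rw [← hD]
      exact D.coeff_ne_of_sub_s_le h7 hst.1 hst.2 (by omega) k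
  · refine ⟨D.t, D.t_pos, D.t_lt, ?_, fun h7 h25 => ?_⟩
    · rintro _ ⟨k, rfl⟩
      rw [← hD]
      exact D.coeff_mem_Icc_of_s_le hst.1 hst.2 k
    · rintro _ ⟨k, rfl⟩
      rw [← hD]
      exact D.coeff_ne_of_s_le h7 hst.1 hst.2 h25 k

theorem ncard_Icc_neg (p : ℕ) (b : ℤ) : (Set.Icc (-b) (p - b)).ncard = p + 1 := by
  have := ncard_Icc_sub p (p - b)
  rwa [sub_sub_cancel_left] at this

theorem natAbs_le_height {n : ℕ} {a : ℤ} (ha : a ∈ coeffSet n) : a.natAbs ≤ height n := by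
  obtain ⟨k, rfl⟩ := ha
  exact (isGreatest_height n).2 ⟨k, rfl⟩

/-- The height of an optimal cyclotomic polynomial is neither `1` nor `5`: for height `5` one
would need `p = 7`, and an end point `± 5` of the coefficient interval. -/
theorem one_five_notMem_optimalHeights {m : ℕ} (hm : m ∈ optimalHeights) : m ≠ 1 ∧ m ≠ 5 := by
  obtain ⟨n, ⟨p, q, r, h, rfl, hcard⟩, rfl⟩ := hm
  obtain ⟨b, hb0, hbp, hsub, h7⟩ := exists_coeffSet_subset_Icc h
  have heq : coeffSet (p * q * r) = Set.Icc (-b) (p - b) :=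
    Set.eq_of_subset_of_ncard_le hsub (by rw [hcard, ncard_Icc_neg]) (Set.finite_Icc _ _)
  have hbot : -b ∈ coeffSet (p * q * r) := by rw [heq]; constructor <;> omega
  have htop : p - b ∈ coeffSet (p * q * r) := by rw [heq]; constructor <;> omega
  have h1 := natAbs_le_height hbot
  have h2 := natAbs_le_height htop
  have hp2 := h.2.2.2.1
  refine ⟨fun h1' => by omega, fun h5 => ?_⟩
  obtain ⟨k, hk⟩ := (isGreatest_height (p * q * r)).1
  have hmem : (Polynomial.cyclotomic (p * q * r) ℤ).coeff k ∈ coeffSet (p * q * r) := ⟨k, rfl⟩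
  have hk5 : |(Polynomial.cyclotomic (p * q * r) ℤ).coeff k| = 5 := by
    rw [Int.abs_eq_natAbs, show ((Polynomial.cyclotomic (p * q * r) ℤ).coeff k).natAbs = 5 from
      hk.trans h5]
    rfl
  have hmem' := hmem
  rw [heq, Set.mem_Icc] at hmem'
  have hp10 : p ≤ 10 := by omega
  rcases (abs_eq (by norm_num)).1 hk5 with hc | hc
  · have hp7 : p = 7 ∨ p = 6 ∨ p = 8 ∨ p = 9 ∨ p = 10 := by omega
    rcases hp7 with rfl | rfl | rfl | rfl | rfl
    · exact h7 rfl (by omega) _ hmem hk5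
    all_goals exact absurd h.1 (by norm_num)
  · have hp7 : p = 7 ∨ p = 6 ∨ p = 8 ∨ p = 9 ∨ p = 10 := by omega
    rcases hp7 with rfl | rfl | rfl | rfl | rfl
    · exact h7 rfl (by omega) _ hmem hk5
    all_goals exact absurd h.1 (by norm_num)

/-! ### Small heights, and the hypothesis on prime gaps -/

/-- The data of `n = 231 = 3 * 7 * 11`. -/
def datum231 : TernaryDatum where
  p := 3
  q := 7
  r := 11
  s := 1
  t := 2
  u := 5
  w := 3
  prime_p := by norm_num
  prime_q := by norm_num
  prime_r := by norm_num
  two_lt_p := by norm_num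
  two_lt_q := by norm_num
  p_ne_q := by norm_num
  p_ne_r := by norm_num
  q_ne_r := by norm_num
  s_pos := by norm_num
  s_lt := by norm_num
  u_pos := by norm_num
  u_lt := by norm_num
  bezout := by norm_num
  t_pos := by norm_num
  t_lt := by norm_num
  t_inv := by norm_num
  w_inv := by norm_num

/-- The data of `n = 2717 = 11 * 13 * 19`; for the bounds of `coeff_mem_Icc_of_sub_s_le`, the
prime `19` has to play the role of `q`. -/
def datum2717 : TernaryDatum where
  p := 11
  q := 19
  r := 13
  s := 7
  t := 6
  u := 7
  w := 2
  prime_p := by norm_num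
  prime_q := by norm_num
  prime_r := by norm_num
  two_lt_p := by norm_num
  two_lt_q := by norm_num
  p_ne_q := by norm_num
  p_ne_r := by norm_num
  q_ne_r := by norm_num
  s_pos := by norm_num
  s_lt := by norm_num
  u_pos := by norm_num
  u_lt := by norm_num
  bezout := by norm_num
  t_pos := by norm_num
  t_lt := by norm_num
  t_inv := by norm_num
  w_inv := by norm_num

theorem coeff_cyclotomic_eq_zero_of_le {n k : ℕ} (hn : 1 < n) (hk : n ≤ k) :
    (Polynomial.cyclotomic n ℤ).coeff k = 0 := by
  refine Polynomial.coeff_eq_zero_of_natDegree_lt ?_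
  rw [Polynomial.natDegree_cyclotomic]
  exact (Nat.totient_lt n hn).trans_le hk

theorem one_le_height (n : ℕ) : 1 ≤ height n := by
  refine (isGreatest_height n).2 ⟨(Polynomial.cyclotomic n ℤ).natDegree, ?_⟩
  have := (Polynomial.cyclotomic.monic n ℤ).coeff_natDegree
  simp [this]

theorem height_231 : height 231 = 1 := by
  refine le_antisymm ?_ (one_le_height _)
  obtain ⟨k, hk⟩ := (isGreatest_height 231).1
  rw [← hk]
  rcases lt_or_ge k 231 with h | h
  · have key : ∀ k : ℕ, k < 231 → |∑ i ∈ Finset.range 3, datum231.sliceDiff ((k : ℤ) / 11)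
        (((k : ℤ) - i) * 3 % 7) (((k : ℤ) - i) * (1 * 2) % 3)| ≤ 1 := by
      decide +kernel
    have h1 := datum231.coeff_eq_sum_sliceDiff k
    have h2 := (congrArg abs h1).trans_le (key k h)
    change |(Polynomial.cyclotomic 231 ℤ).coeff k| ≤ 1 at h2
    rw [abs_le] at h2
    simp only
    omega
  · simp [coeff_cyclotomic_eq_zero_of_le (by norm_num) h]

/-- For `n = 2717`, this says that the `i`-th summand of Kaplan's formula for the coefficient at
`k` has `y < 6` but is not equal to `1`, in terms of natural numbers. -/
def topFails (k i : ℕ) : Bool :=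
  let x := (k + 209 - i) * 2 % 19
  let y := (k + 209 - i) * 42 % 11
  let z := k / 13
  Nat.blt y 6 &&
    !((Nat.blt x 7 && Nat.ble (11 * x + 19 * y) z &&
        !(Nat.blt y 2 && Nat.ble (11 * x + 19 * y + 95) z)) ||
      (Nat.ble 7 x && Nat.ble 2 y && Nat.ble (11 * x + 19 * y + 95) (z + 209)))

theorem sliceDiff_ne_of_topFails {k i : ℕ} (hi : i < 11) (h : topFails k i = true) :
    datum2717.sliceDiff ((k : ℤ) / 13) (((k : ℤ) - i) * 2 % 19) (((k : ℤ) - i) * (7 * 6) % 11) ≠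
      if 0 ≤ ((k : ℤ) - i) * (7 * 6) % 11 ∧ ((k : ℤ) - i) * (7 * 6) % 11 < 6 then 1 else 0 := by
  have hx : ((k : ℤ) - i) * 2 % 19 = ((k + 209 - i) * 2 % 19 : ℕ) := by omega
  have hy : ((k : ℤ) - i) * (7 * 6) % 11 = ((k + 209 - i) * 42 % 11 : ℕ) := by omega
  have hz : (k : ℤ) / 13 = (k / 13 : ℕ) := by omega
  have hy11 := Nat.mod_lt ((k + 209 - i) * 42) (show 0 < 11 by norm_num)
  rw [hx, hy, hz]
  simp only [topFails] at h
  generalize (k + 209 - i) * 2 % 19 = x at *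
  generalize (k + 209 - i) * 42 % 11 = y at *
  generalize k / 13 = z at *
  simp only [Bool.and_eq_true, Nat.blt_eq, Bool.not_eq_true', Bool.or_eq_false_iff,
    Bool.and_eq_false_iff, Bool.not_eq_false', Nat.ble_eq] at h
  simp only [Bool.eq_false_iff, ne_eq, Nat.blt_eq, Nat.ble_eq] at h
  rw [if_pos ⟨by omega, by omega⟩]
  change truncCoeff 11 19 7 7 z x y - truncCoeff 11 19 7 7 z x ((y - 6) % 11) ≠ 1
  have e : ((y : ℤ) - 6) % 11 = y + 5 := by omega
  rw [e]
  simp only [truncCoeff]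
  split_ifs <;> omega

/-- All coefficients lie in `[-5, 6]`. The coefficient `6` would need all summands with `y < 6` to
be `1`, which is checked to fail for each index, and `-5` is the coefficient at `1008`. -/
theorem height_2717 : height 2717 = 5 := by
  have bound := datum2717.coeff_mem_Icc_of_sub_s_le (by decide) (by decide)
  have key : ∀ k < 2717, (List.range 11).any (topFails k) = true := by decide +kernel
  have top : ∀ k, (Polynomial.cyclotomic 2717 ℤ).coeff k ≠ 6 := by
    intro k hk6
    rcases lt_or_ge k 2717 with h | h
    · obtain ⟨i, hi, hfail⟩ := List.any_eq_true.1 (key k h)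
      rw [List.mem_range] at hi
      exact sliceDiff_ne_of_topFails hi hfail
        (datum2717.sliceDiff_eq_of_coeff_eq_t (by decide) (by decide) hk6 i hi)
    · rw [coeff_cyclotomic_eq_zero_of_le (by norm_num) h] at hk6
      norm_num at hk6
  have attained : (Polynomial.cyclotomic 2717 ℤ).coeff 1008 = -5 := by
    refine (datum2717.coeff_eq_sum_sliceDiff 1008).trans ?_
    decide +kernel
  refine (isGreatest_height 2717).unique ⟨⟨1008, by simp only [attained]; rfl⟩, ?_⟩
  rintro _ ⟨k, rfl⟩
  have h1 : (Polynomial.cyclotomic 2717 ℤ).coeff k ∈ Set.Icc (-5 : ℤ) 6 := bound k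
  have h2 := top k
  rw [Set.mem_Icc] at h1
  simp only
  omega

/-- All small heights covered by `mem_optimalHeights_of_le`. -/
theorem exists_prime_of_lt {m : ℕ} (hm : m < 63) (hm2 : 2 ≤ m) (hm5 : m ≠ 5) :
    ∃ p < 128, ∃ h < 8, 2 * m = p + 1 + 2 * h ∧ 4 * h ^ 2 + 2 * h + 3 ≤ p ∧ p.Prime := by
  revert m
  decide +kernel

/-- Under the hypothesis on prime gaps, the largest prime `p ≤ 2 m - 1` satisfies the condition
of `mem_optimalHeights_of_le`. -/
theorem exists_prime_of_gap
    (hgap : ∀ n : ℕ, 31 ≤ n →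
      (nthPrime (n + 1) : ℝ) - (nthPrime n : ℝ) < Real.sqrt (nthPrime n : ℝ) + 1)
    {m : ℕ} (hm : 64 ≤ m) :
    ∃ p h : ℕ, 2 * m = p + 1 + 2 * h ∧ 4 * h ^ 2 + 2 * h + 3 ≤ p ∧ p.Prime := by
  set n := Nat.count Nat.Prime (2 * m) with hn
  have hn31 : 31 ≤ n := by
    have h1 : Nat.count Nat.Prime 128 = 31 := by decide +kernel
    rw [← h1]
    exact Nat.count_monotone _ (by omega)
  have hgapn := hgap n hn31
  have hinf := Nat.infinite_setOfPred_prime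
  have hp := Nat.nth_mem_of_infinite hinf (n - 1)
  have hlt : nthPrime n < 2 * m := Nat.nth_lt_of_lt_count (by omega)
  have hp' := Nat.nth_mem_of_infinite hinf n
  have hge : 2 * m ≤ nthPrime (n + 1) := Nat.le_nth_count hinf _
  change (nthPrime n).Prime at hp
  change (nthPrime (n + 1)).Prime at hp'
  have h127 : 127 ≤ nthPrime n := by
    have h1 : Nat.count Nat.Prime 127 = 30 := by decide +kernel
    exact (Nat.count_le_iff_le_nth hinf).1 (h1.le.trans (by omega))
  generalize nthPrime n = p at *
  generalize nthPrime (n + 1) = p' at *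
  -- Both primes are odd, so `p' ≥ 2 m + 1 = p + 2 h + 2`.
  obtain ⟨a, ha⟩ := hp.odd_of_ne_two (by omega)
  obtain ⟨b, hb⟩ := hp'.odd_of_ne_two (by omega)
  refine ⟨p, m - a - 1, by omega, ?_, hp⟩
  obtain ⟨h, hh⟩ : ∃ h, h = m - a - 1 := ⟨_, rfl⟩
  rw [← hh]
  have h1 : (2 * h + 1 : ℝ) < Real.sqrt p := by
    have : (2 * h + 2 + p : ℝ) ≤ p' := by
      have : 2 * h + 2 + p ≤ p' := by omega
      exact_mod_cast this
    linarith
  have h2 := (Real.lt_sqrt (by positivity)).1 h1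
  have h3 : (2 * h + 1) ^ 2 < p := by exact_mod_cast h2
  rcases Nat.eq_zero_or_pos h with h0 | h0
  · rw [h0]; omega
  · nlinarith

end CyclotomicHeights

theorem mainTheorem10
    (hgap : ∀ n : ℕ, 31 ≤ n →
      (CyclotomicHeights.nthPrime (n + 1) : ℝ) - (CyclotomicHeights.nthPrime n : ℝ)
        < Real.sqrt (CyclotomicHeights.nthPrime n : ℝ) + 1) :
    CyclotomicHeights.heights = CyclotomicHeights.positiveNaturals ∧
    CyclotomicHeights.ternaryHeights = CyclotomicHeights.positiveNaturals ∧
    CyclotomicHeights.optimalHeights = CyclotomicHeights.positiveNaturals \ {1, 5} := by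
  open CyclotomicHeights in
  have opt : ∀ m : ℕ, 2 ≤ m → m ≠ 5 → m ∈ optimalHeights := by
    intro m hm hm5
    have of_prime : ∀ p h : ℕ, 2 * m = p + 1 + 2 * h → 4 * h ^ 2 + 2 * h + 3 ≤ p → p.Prime →
        m ∈ optimalHeights := fun p h h1 h2 hp => mem_optimalHeights_of_le hp (by omega) h1 h2
    rcases lt_trichotomy m 63 with h | rfl | h
    · obtain ⟨p, -, h, -, h1, h2, h3⟩ := exists_prime_of_lt h hm hm5
      exact of_prime p h h1 h2 h3
    · -- The bound on `p` fails for `p = 113`, but `45 * 63 = 26 * 109 + 1`.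
      exact mem_optimalHeights_of_inverse (p := 109) (α := 45) (by norm_num) (by norm_num)
        (Or.inl rfl) (by norm_num) (by norm_num) (by norm_num) (by norm_num) (by norm_num)
    · obtain ⟨p, h, h1, h2, h3⟩ := exists_prime_of_gap hgap h
      exact of_prime p h h1 h2 h3
  have opt_sub : optimalHeights ⊆ ternaryHeights := by
    rintro _ ⟨n, ⟨p, q, r, h, hn, -⟩, rfl⟩
    exact ⟨n, ⟨p, q, r, h, hn⟩, rfl⟩
  have tern_sub : ternaryHeights ⊆ heights := by
    rintro _ ⟨n, ⟨p, q, r, h, rfl⟩, rfl⟩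
    exact ⟨_, Nat.mul_pos (Nat.mul_pos h.1.pos h.2.1.pos) h.2.2.1.pos, rfl⟩
  have heights_sub : heights ⊆ positiveNaturals := by
    rintro _ ⟨n, -, rfl⟩
    exact one_le_height n
  have pos_sub : positiveNaturals ⊆ ternaryHeights := by
    intro m hm
    have hm : 1 ≤ m := hm
    by_cases h1 : m = 1
    · subst h1
      exact ⟨231, ⟨3, 7, 11, by norm_num [IsTernaryTriple], by norm_num⟩, height_231⟩
    by_cases h5 : m = 5
    · subst h5
      exact ⟨2717, ⟨11, 13, 19, by norm_num [IsTernaryTriple], by norm_num⟩, height_2717⟩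
    · exact opt_sub (opt m (by omega) h5)
  refine ⟨(heights_sub).antisymm (pos_sub.trans tern_sub),
    (tern_sub.trans heights_sub).antisymm pos_sub, Set.Subset.antisymm ?_ ?_⟩
  · intro m hm
    obtain ⟨h1, h5⟩ := one_five_notMem_optimalHeights hm
    exact ⟨heights_sub (tern_sub (opt_sub hm)), by simp [h1, h5]⟩
  · rintro m ⟨hm, hm'⟩
    have hm : 1 ≤ m := hm
    simp only [Set.mem_insert_iff, Set.mem_singleton_iff, not_or] at hm'
    exact opt m (by omega) hm'.2
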